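/- Let $\Bbbk$ be a field, $\mathrm{Bialg}_\Bbbk$ the category of $\Bbbk$-bialgebras and $R_0=P:\mathrm{Bialg}_\Bbbk\to\mathcal B_0=\mathrm{Vect}_\Bbbk$ the functor sending a bialgebra $A$ to its space $PA=\{a\in A:\Delta a=a\otimes 1+1\otimes a\}$ of primitive elements. Its left adjoint is $L_0=T$, the tensor algebra with the bialgebra structure in which all $v\in V$ are primitive; the unit is $\eta_0V:V\to PTV$, $v\mapsto v$. For an adjunction $L_n\dashv R_n$ with $R_n:\mathrm{Bialg}_\Bbbk\to\mathcal B_n$, let $\mathcal B_{n+1}$ be the Eilenberg–Moore category of algebras over the monad $R_nL_n$ and $R_{n+1}:\mathrm{Bialg}_\Bbbk\to\mathcal B_{n+1}$ the comparison functor. A functor $R$ has a monadic decomposition of monadic length $N\in\mathbb N$ if, starting from $R_0=R$, there are functors $R_0,\dots,R_N$ with left adjoints $L_0,\dots,L_N$, each $R_{n+1}$ ($n<N$) being the comparison functor of $L_n\dashv R_n$, such that $L_N$ is full and faithful while $L_n$ is not full and faithful for $n<N$. An adjunction is idempotent if the multiplication of its monad is an isomorphism. **Theorem.** The functor $P$ has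 a monadic decomposition of monadic length $N$ for some $N\le 2$. Moreover $R_1$ has a left adjoint $L_1$, for every such $L_1$ the functor $R_2$ has a left adjoint $L_2$, every such $L_2$ is full and faithful, and the following hold for all such $L_1$, $L_2$. 1. For every $(V_0,\mu_0)\in\mathcal B_1$, $$L_1(V_0,\mu_0)\cong\frac{TV_0}{\left(\mathrm{Im}(\mathrm{Id}_{PTV_0}-\eta_0V_0\circ\mu_0)\right)}$$ as bialgebras (the quotient by the two-sided ideal generated by the indicated set, with the quotient bialgebra structure). The isomorphism carries the canonical map $TV_0\to L_1(V_0,\mu_0)$, which corresponds under $T\dashv P$ to the linear map underlying the unit of $L_1\dashv R_1$, to the projection. 2. The adjunction $(L_1,R_1)$ is idempotent. 3. Let $V_2=((V_0,\mu_0),\mu_1)\in\mathcal B_2$. * If $\mathrm{char}\,\Bbbk=0$, then $xy-yx\in PTV_0$ for all $x,y\in V_0$ (products taken in $TV_0$). With $[x,y]:=\mu_0(xy-yx)$, the pair $(V_0,[-,-])$ is a Lie algebra, and $L_2V_2$ is its universal enveloping algebra: $$L_2V_2\cong\mathfrak UV_0:=\frac{TV_0}{(xy-yx-[x,y]\mid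 x,y\in V_0)}.$$ * If $\mathrm{char}\,\Bbbk=p$ is prime, then $xy-yx,\ x^p\in PTV_0$ for all $x,y\in V_0$. With $[x,y]:=\mu_0(xy-yx)$ and $x^{[p]}:=\mu_0(x^p)$, the triple $(V_0,[-,-],-^{[p]})$ is a restricted Lie algebra, and $L_2V_2$ is its restricted enveloping algebra: $$L_2V_2\cong\mathfrak uV_0:=\frac{TV_0}{(xy-yx-[x,y],\ x^p-x^{[p]}\mid x,y\in V_0)}.$$ In both cases the isomorphism is one of bialgebras (the quotients carry the quotient bialgebra structure), and it carries the canonical map $TV_0\to L_2V_2$, which corresponds under $T\dashv P$ to the linear map underlying the unit of $L_2\dashv R_2$, to the projection. Here a restricted Lie algebra over a field of characteristic $p$ is a Lie algebra with a map $x\mapsto x^{[p]}$ such that $(cx)^{[p]}=c^px^{[p]}$, $[x^{[p]},y]=(\mathrm{ad}\,x)^p(y)$ and $(x+y)^{[p]}=x^{[p]}+y^{[p]}+\sum_{i=1}^{p-1}s_i(x,y)$, where $i\,s_i(x,y)$ is the coefficient of $t^{i-1}$ in $(\mathrm{ad}(tx+y))^{p-1}(x)$. -/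

import Mathlib

open CategoryTheory TensorProduct

universe u v₁ u₁ v₂ u₂

noncomputable section

/-! ### Monadic decompositions -/

section MonadicDecomposition

/-- An adjunction is idempotent when the multiplication of the monad it generates is an
isomorphism. -/
def IsIdempotentAdjunction {A : Type u₁} [Category.{v₁} A] {B : Type u₂} [Category.{v₂} B]
    {L : B ⥤ A} {R : A ⥤ B} (adj : L ⊣ R) : Prop :=
  IsIso adj.toMonad.μ

/-- `R` has a monadic decomposition of monadic length exactly `N`: there are functors
`R₀ = R, R₁, …, R_N` with left adjoints `L₀, …, L_N`, each `R_{n+1}` being the comparison functor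
of `L_n ⊣ R_n` into the Eilenberg-Moore category of its monad, such that `L_N` is full and
faithful and no `L_n` with `n < N` is. -/
def HasMonadicDecomposition {A : Type u₁} [Category.{v₁} A] :
    (N : ℕ) → {B : Type (max u₂ v₂)} → [Category.{v₂} B] → (A ⥤ B) → Prop
  | 0, B, _, R => ∃ L : B ⥤ A, Nonempty (L ⊣ R) ∧ L.Full ∧ L.Faithful
  | N + 1, B, _, R => ∃ (L : B ⥤ A) (adj : L ⊣ R), ¬ (L.Full ∧ L.Faithful) ∧
      HasMonadicDecomposition N (Monad.comparison adj)

end MonadicDecomposition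

/-! ### Primitive elements and quotients by primitive elements -/

section Primitives

variable (k : Type u) [Field k]

/-- The subspace of primitive elements of a bialgebra, those with `Δ a = a ⊗ 1 + 1 ⊗ a`. -/
def primitives (A : Type u) [Ring A] [Bialgebra k A] : Submodule k A where
  carrier := {a | Coalgebra.comul (R := k) a = a ⊗ₜ[k] 1 + 1 ⊗ₜ[k] a}
  add_mem' := by
    intro a b ha hb
    simp only [Set.mem_ofPred_eq] at *
    rw [map_add, ha, hb, TensorProduct.add_tmul, TensorProduct.tmul_add]
    abel
  zero_mem' := by simp
  smul_mem' := by
    intro c a ha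
    simp only [Set.mem_ofPred_eq] at *
    rw [map_smul, ha, smul_add, TensorProduct.smul_tmul', TensorProduct.tmul_smul]

variable {k}

lemma mem_primitives {A : Type u} [Ring A] [Bialgebra k A] {a : A} :
    a ∈ primitives k A ↔ Coalgebra.comul (R := k) a = a ⊗ₜ[k] 1 + 1 ⊗ₜ[k] a := Iff.rfl

lemma counit_of_mem_primitives {A : Type u} [Ring A] [Bialgebra k A] {a : A}
    (ha : a ∈ primitives k A) : Coalgebra.counit (R := k) a = 0 := by
  have h := Coalgebra.rTensor_counit_comul (R := k) a
  rw [mem_primitives.1 ha] at h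
  simp only [map_add, LinearMap.rTensor_tmul, Bialgebra.counit_one] at h
  have h2 := congrArg (Coalgebra.counit (R := k) ∘ₗ (TensorProduct.lid k A).toLinearMap) h
  simpa using h2

lemma map_mem_primitives {A B : Type u} [Ring A] [Bialgebra k A] [Ring B] [Bialgebra k B]
    (f : A →ₐc[k] B) {a : A} (ha : a ∈ primitives k A) : f a ∈ primitives k B := by
  rw [mem_primitives] at *
  rw [← CoalgHomClass.map_comp_comul_apply, ha]
  simp

lemma commutator_mem_primitives {A : Type u} [Ring A] [Bialgebra k A] {a b : A}
    (ha : a ∈ primitives k A) (hb : b ∈ primitives k A) : a * b - b * a ∈ primitives k A := by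
  rw [mem_primitives] at *
  rw [map_sub, Bialgebra.comul_mul, Bialgebra.comul_mul, ha, hb]
  simp only [add_mul, mul_add, Algebra.TensorProduct.tmul_mul_tmul, one_mul, mul_one,
    TensorProduct.sub_tmul, TensorProduct.tmul_sub]
  abel

lemma pow_mem_primitives (p : ℕ) [Fact p.Prime] [CharP k p] {A : Type u} [Ring A] [Bialgebra k A]
    {a : A} (ha : a ∈ primitives k A) : a ^ p ∈ primitives k A := by
  rw [mem_primitives] at *
  have hcomm : Commute (a ⊗ₜ[k] (1 : A)) ((1 : A) ⊗ₜ[k] a) := by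
    simp [Commute, SemiconjBy]
  rcases subsingleton_or_nontrivial (A ⊗[k] A) with h | h
  · exact Subsingleton.elim _ _
  · have : CharP (A ⊗[k] A) p := charP_of_injective_algebraMap' k p
    rw [Bialgebra.comul_pow, ha, add_pow_char_of_commute _ hcomm]
    simp [Algebra.TensorProduct.tmul_pow]

/-- The two-sided ideal generated by a set, as a Mathlib ideal. -/
abbrev twoSidedIdealSpan {A : Type u} [Ring A] (S : Set A) : Ideal A :=
  (TwoSidedIdeal.span S).asIdeal

lemma isCoideal_twoSidedIdealSpan {A : Type u} [Ring A] [Bialgebra k A] {S : Set A}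
    (hS : S ⊆ primitives k A) :
    ((twoSidedIdealSpan S).restrictScalars k).IsCoideal := by
  set I := twoSidedIdealSpan S with hI
  have hSI : ∀ s ∈ S, Ideal.Quotient.mkₐ k I s = 0 := fun s hs =>
    Ideal.Quotient.eq_zero_iff_mem.2 (TwoSidedIdeal.mem_asIdeal.2 (TwoSidedIdeal.subset_span hs))
  have key : ∀ {C : Type u} [Ring C] (f : A →+* C), (∀ s ∈ S, f s = 0) → ∀ x ∈ I, f x = 0 := by
    intro C _ f hf x hx
    have : TwoSidedIdeal.span S ≤ TwoSidedIdeal.ker f :=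
      TwoSidedIdeal.span_le.2 fun s hs => (TwoSidedIdeal.mem_ker f).2 (hf s hs)
    exact (TwoSidedIdeal.mem_ker f).1 (this (TwoSidedIdeal.mem_asIdeal.1 hx))
  constructor
  · intro x hx
    exact key (Bialgebra.counitAlgHom k A : A →+* k)
      (fun s hs => counit_of_mem_primitives (hS hs)) x hx
  · intro x hx
    refine key ((Algebra.TensorProduct.map (Ideal.Quotient.mkₐ k I) (Ideal.Quotient.mkₐ k I)).comp
      (Bialgebra.comulAlgHom k A)).toRingHom (fun s hs => ?_) x hx
    change Algebra.TensorProduct.map (Ideal.Quotient.mkₐ k I) (Ideal.Quotient.mkₐ k I)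
      (Coalgebra.comul (R := k) s) = 0
    rw [mem_primitives.1 (hS hs), map_add, Algebra.TensorProduct.map_tmul,
      Algebra.TensorProduct.map_tmul, hSI s hs, TensorProduct.zero_tmul, TensorProduct.tmul_zero,
      add_zero]

/-- The quotient bialgebra `A / (S)` of a bialgebra by the two-sided ideal generated by a set of
primitive elements. -/
def quotientByPrimitives {A : Type u} [Ring A] [Bialgebra k A] (S : Set A)
    (hS : S ⊆ primitives k A) : BialgCat.{u} k :=
  haveI := isCoideal_twoSidedIdealSpan hS
  BialgCat.of k (A ⧸ twoSidedIdealSpan S)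

/-- The projection `A → A / (S)`. -/
def quotientByPrimitivesMk {A : Type u} [Ring A] [Bialgebra k A] (S : Set A)
    (hS : S ⊆ primitives k A) : BialgCat.of k A ⟶ quotientByPrimitives S hS :=
  haveI := isCoideal_twoSidedIdealSpan hS
  BialgCat.ofHom (Bialgebra.Quotient.mkBialgHom (R := k) (twoSidedIdealSpan S))

end Primitives

/-! ### The tensor bialgebra and the adjunction `T ⊣ P` -/

section TensorBialgebra

variable (k : Type u) [Field k]

/-- The bialgebra structure on the tensor algebra for which every `v : V` is primitive. -/
instance tensorAlgebraBialgebra (V : Type u) [AddCommGroup V] [Module k V] :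
    Bialgebra k (TensorAlgebra k V) :=
  .ofAlgHom
    (TensorAlgebra.lift k ((TensorProduct.mk k _ _).flip 1 ∘ₗ TensorAlgebra.ι k +
      TensorProduct.mk k _ _ 1 ∘ₗ TensorAlgebra.ι k))
    (TensorAlgebra.lift k 0)
    (by
      ext x
      simp [Algebra.TensorProduct.one_def, TensorProduct.add_tmul, TensorProduct.tmul_add]
      abel)
    (by ext x; simp)
    (by ext x; simp)

variable {k}

lemma ι_mem_primitives {V : Type u} [AddCommGroup V] [Module k V] (v : V) :
    TensorAlgebra.ι k v ∈ primitives k (TensorAlgebra k V) :=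
  TensorAlgebra.lift_ι_apply _ v

/-- `V → P(TV)`, `v ↦ v`. -/
def primitiveι (V : Type u) [AddCommGroup V] [Module k V] :
    V →ₗ[k] primitives k (TensorAlgebra k V) :=
  (TensorAlgebra.ι k).codRestrict _ ι_mem_primitives

/-- A linear map `V → P(A)` extends to a bialgebra map `TV → A`. -/
def tensorLift {V A : Type u} [AddCommGroup V] [Module k V] [Ring A] [Bialgebra k A]
    (f : V →ₗ[k] primitives k A) : TensorAlgebra k V →ₐc[k] A :=
  .ofAlgHom (TensorAlgebra.lift k ((primitives k A).subtype ∘ₗ f))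
    (by
      ext v
      have h1 := counit_of_mem_primitives (ι_mem_primitives (k := k) v)
      have h2 := counit_of_mem_primitives (f v).2
      simp [h1, h2])
    (by
      ext v
      have h1 := mem_primitives.1 (ι_mem_primitives (k := k) v)
      have h2 := mem_primitives.1 (f v).2
      simp [h1, h2])

@[simp] lemma tensorLift_ι {V A : Type u} [AddCommGroup V] [Module k V] [Ring A] [Bialgebra k A]
    (f : V →ₗ[k] primitives k A) (v : V) : tensorLift f (TensorAlgebra.ι k v) = (f v : A) :=
  TensorAlgebra.lift_ι_apply _ v

lemma tensor_bialgHom_ext {V A : Type u} [AddCommGroup V] [Module k V] [Ring A] [Bialgebra k A]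
    {f g : TensorAlgebra k V →ₐc[k] A}
    (h : ∀ v, f (TensorAlgebra.ι k v) = g (TensorAlgebra.ι k v)) : f = g := by
  have : (f : TensorAlgebra k V →ₐ[k] A) = g := TensorAlgebra.hom_ext (LinearMap.ext h)
  ext x
  exact DFunLike.congr_fun this x

/-- A bialgebra map restricts to primitive elements. -/
def primitivesMap {A B : Type u} [Ring A] [Bialgebra k A] [Ring B] [Bialgebra k B]
    (f : A →ₐc[k] B) : primitives k A →ₗ[k] primitives k B :=
  ((f : A →ₐ[k] B).toLinearMap).restrict fun _ ha => map_mem_primitives f ha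

variable (k)

/-- The functor `P` sending a bialgebra to its space of primitive elements. -/
def primitivesFunctor : BialgCat.{u} k ⥤ ModuleCat.{u} k where
  obj A := ModuleCat.of k (primitives k A)
  map f := ModuleCat.ofHom (primitivesMap f.toBialgHom)

/-- The functor `T` sending a vector space to its tensor algebra. -/
def tensorFunctor : ModuleCat.{u} k ⥤ BialgCat.{u} k where
  obj V := BialgCat.of k (TensorAlgebra k V)
  map {V W} f := BialgCat.ofHom (tensorLift (primitiveι W ∘ₗ f.hom))
  map_id V := by
    apply BialgCat.hom_ext
    refine tensor_bialgHom_ext fun v => ?_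
    exact tensorLift_ι _ v
  map_comp f g := by
    apply BialgCat.hom_ext
    refine tensor_bialgHom_ext fun v => ?_
    refine (tensorLift_ι _ v).trans ?_
    symm
    refine (congrArg _ (tensorLift_ι _ v)).trans ?_
    exact tensorLift_ι _ _

/-- The adjunction `T ⊣ P`: bialgebra maps `TV → A` are linear maps `V → P(A)`. -/
def tensorPrimitivesAdjunction : tensorFunctor k ⊣ primitivesFunctor k :=
  Adjunction.mkOfHomEquiv
    { homEquiv V A :=
        { toFun f := ModuleCat.ofHom (primitivesMap f.toBialgHom ∘ₗ primitiveι V)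
          invFun g := BialgCat.ofHom (tensorLift g.hom)
          left_inv f := by
            apply BialgCat.hom_ext
            refine tensor_bialgHom_ext fun v => ?_
            exact tensorLift_ι _ v
          right_inv g := by
            apply ModuleCat.hom_ext
            refine LinearMap.ext fun v => ?_
            exact Subtype.ext (tensorLift_ι (k := k) (A := A) g.hom v) }
      homEquiv_naturality_left_symm f g := by
        apply BialgCat.hom_ext
        refine tensor_bialgHom_ext fun v => ?_
        refine (tensorLift_ι _ v).trans ?_
        symm
        refine (congrArg _ (tensorLift_ι _ v)).trans ?_
        exact tensorLift_ι _ _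
      homEquiv_naturality_right f g := rfl }

/-- The category `B₁` of algebras over the monad `PT`. -/
abbrev PTAlgebra : Type (u + 1) := (tensorPrimitivesAdjunction k).toMonad.Algebra

/-- The first comparison functor `R₁ : Bialg ⥤ B₁`. -/
abbrev comparisonOne : BialgCat.{u} k ⥤ PTAlgebra k :=
  Monad.comparison (tensorPrimitivesAdjunction k)

variable {k}

/-- The structure map `μ₀ : P(TV₀) → V₀` of an object `(V₀, μ₀)` of `B₁`. -/
def structureMap (V₁ : PTAlgebra k) : primitives k (TensorAlgebra k V₁.A) →ₗ[k] V₁.A :=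
  ModuleCat.Hom.hom V₁.a

/-- The image of `Id - η₀ ∘ μ₀ : P(TV₀) → P(TV₀)`, as a set of elements of `TV₀`. -/
def structureRelations (V₁ : PTAlgebra k) : Set (TensorAlgebra k V₁.A) :=
  Subtype.val '' (LinearMap.range (LinearMap.id - primitiveι V₁.A ∘ₗ structureMap V₁) :
    Set (primitives k (TensorAlgebra k V₁.A)))

lemma structureRelations_subset (V₁ : PTAlgebra k) :
    structureRelations V₁ ⊆ primitives k (TensorAlgebra k V₁.A) := by
  rintro _ ⟨z, -, rfl⟩
  exact z.2

/-- `[x, y] = μ₀ (xy - yx)`, given that all `xy - yx` are primitive. -/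
def inducedBracket (V₁ : PTAlgebra k)
    (hcomm : ∀ x y : V₁.A, TensorAlgebra.ι k x * TensorAlgebra.ι k y -
      TensorAlgebra.ι k y * TensorAlgebra.ι k x ∈ primitives k (TensorAlgebra k V₁.A)) :
    V₁.A → V₁.A → V₁.A :=
  fun x y => structureMap V₁ ⟨_, hcomm x y⟩

/-- `x^[p] = μ₀ (x ^ p)`, given that all `x ^ p` are primitive. -/
def inducedPower (V₁ : PTAlgebra k) (p : ℕ)
    (hpow : ∀ x : V₁.A, TensorAlgebra.ι k x ^ p ∈ primitives k (TensorAlgebra k V₁.A)) :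
    V₁.A → V₁.A :=
  fun x => structureMap V₁ ⟨_, hpow x⟩

/-- For a left adjoint `L₁` of `R₁`, the canonical map `TV₀ → L₁(V₀, μ₀)`: it corresponds under
`T ⊣ P` to the map `V₀ → P(L₁(V₀, μ₀))` underlying the unit of `L₁ ⊣ R₁`. -/
def canonicalOne {L₁ : PTAlgebra k ⥤ BialgCat.{u} k} (adj₁ : L₁ ⊣ comparisonOne k)
    (V₁ : PTAlgebra k) : BialgCat.of k (TensorAlgebra k V₁.A) ⟶ L₁.obj V₁ :=
  ((tensorPrimitivesAdjunction k).homEquiv V₁.A (L₁.obj V₁)).symm (adj₁.unit.app V₁).f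

/-- For a left adjoint `L₂` of the second comparison functor `R₂`, the canonical map
`TV₀ → L₂((V₀, μ₀), μ₁)`: it corresponds under `T ⊣ P` to the map `V₀ → P(L₂((V₀, μ₀), μ₁))`
underlying the unit of `L₂ ⊣ R₂`. -/
def canonicalTwo {L₁ : PTAlgebra k ⥤ BialgCat.{u} k} {adj₁ : L₁ ⊣ comparisonOne k}
    {L₂ : adj₁.toMonad.Algebra ⥤ BialgCat.{u} k} (adj₂ : L₂ ⊣ Monad.comparison adj₁)
    (V₂ : adj₁.toMonad.Algebra) : BialgCat.of k (TensorAlgebra k V₂.A.A) ⟶ L₂.obj V₂ :=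
  ((tensorPrimitivesAdjunction k).homEquiv V₂.A.A (L₂.obj V₂)).symm (adj₂.unit.app V₂).f.f

end TensorBialgebra

/-! ### Lie algebras, restricted Lie algebras and their enveloping algebras -/

section Lie

variable (k : Type u) [Field k] {V : Type u} [AddCommGroup V] [Module k V]

/-- `b` is a Lie bracket on the vector space `V`. -/
structure IsLieBracket (b : V → V → V) : Prop where
  add_left : ∀ x y z, b (x + y) z = b x z + b y z
  add_right : ∀ x y z, b x (y + z) = b x y + b x z
  smul_left : ∀ (c : k) (x y), b (c • x) y = c • b x y
  smul_right : ∀ (c : k) (x y), b x (c • y) = c • b x y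
  self : ∀ x, b x x = 0
  jacobi : ∀ x y z, b x (b y z) + b y (b z x) + b z (b x y) = 0

/-- The Mathlib Lie ring given by a Lie bracket. -/
abbrev IsLieBracket.lieRing {b : V → V → V} (h : IsLieBracket k b) : LieRing V where
  bracket := b
  add_lie := h.add_left
  lie_add := h.add_right
  lie_self := h.self
  leibniz_lie x y z := by
    have skew : ∀ u v, b u v = - b v u := fun u v => by
      have := h.self (u + v)
      rw [h.add_left, h.add_right, h.add_right, h.self, h.self, zero_add, add_zero] at this
      exact eq_neg_of_add_eq_zero_left this
    have hneg : ∀ u v, b u (-v) = - b u v := fun u v => by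
      have := h.smul_right (-1) u v
      simpa using this
    have hj := h.jacobi x y z
    change b x (b y z) = b (b x y) z + b y (b x z)
    rw [skew (b x y) z, skew x z, hneg, ← sub_eq_zero, ← hj]
    abel

/-- The Mathlib Lie algebra given by a Lie bracket. -/
abbrev IsLieBracket.lieAlgebra {b : V → V → V} (h : IsLieBracket k b) :
    letI := h.lieRing
    LieAlgebra k V :=
  letI := h.lieRing
  { lie_smul := fun c x y => h.smul_right c x y }

/-- `adCoeff b x y m j` is the coefficient of `t ^ j` in `(ad (t x + y)) ^ m (x)`, computed in
`V[t]` for the bracket `b`. -/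
def adCoeff (b : V → V → V) (x y : V) : ℕ → ℕ → V
  | 0, 0 => x
  | 0, _ + 1 => 0
  | m + 1, 0 => b y (adCoeff b x y m 0)
  | m + 1, j + 1 => b x (adCoeff b x y m j) + b y (adCoeff b x y m (j + 1))

/-- `(V, b, q)` is a restricted Lie algebra in the sense of Jacobson, with `p`-operation
`q x = x^[p]`, over a field `k` of characteristic `p`. In `pmap_add`, the `i`-th summand is
`s_i(x, y)`, where `i s_i(x, y)` is the coefficient of `t ^ (i - 1)` in
`(ad (t x + y)) ^ (p - 1) (x)`. -/
structure IsRestrictedLie (p : ℕ) (b : V → V → V) (q : V → V) : Prop where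
  isLieBracket : IsLieBracket k b
  pmap_smul : ∀ (c : k) (x), q (c • x) = c ^ p • q x
  ad_pmap : ∀ x y, b (q x) y = (b x)^[p] y
  pmap_add : ∀ x y, q (x + y) = q x + q y +
    ∑ i ∈ Finset.Icc 1 (p - 1), (i : k)⁻¹ • adCoeff b x y (p - 1) (i - 1)

/-- The elements `xy - yx - [x,y]` of `TV`. -/
def lieRelations (b : V → V → V) : Set (TensorAlgebra k V) :=
  {r | ∃ x y : V, r = TensorAlgebra.ι k x * TensorAlgebra.ι k y -
    TensorAlgebra.ι k y * TensorAlgebra.ι k x - TensorAlgebra.ι k (b x y)}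

/-- The elements `x ^ p - x^[p]` of `TV`. -/
def powerRelations (p : ℕ) (q : V → V) : Set (TensorAlgebra k V) :=
  {r | ∃ x : V, r = TensorAlgebra.ι k x ^ p - TensorAlgebra.ι k (q x)}

lemma lieRelations_subset (b : V → V → V) :
    lieRelations k b ⊆ primitives k (TensorAlgebra k V) := by
  rintro _ ⟨x, y, rfl⟩
  exact Submodule.sub_mem _
    (commutator_mem_primitives (ι_mem_primitives x) (ι_mem_primitives y)) (ι_mem_primitives _)

lemma restrictedRelations_subset (p : ℕ) [Fact p.Prime] [CharP k p] (b : V → V → V) (q : V → V) :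
    lieRelations k b ∪ powerRelations k p q ⊆ primitives k (TensorAlgebra k V) := by
  refine Set.union_subset (lieRelations_subset k b) ?_
  rintro _ ⟨x, rfl⟩
  exact Submodule.sub_mem _ (pow_mem_primitives p (ι_mem_primitives x)) (ι_mem_primitives _)

/-- The enveloping algebra `TV / (xy - yx - [x,y])`, with the quotient bialgebra structure. -/
def envelopingBialgebra (b : V → V → V) : BialgCat.{u} k :=
  quotientByPrimitives (lieRelations k b) (lieRelations_subset k b)

/-- The projection of `TV` onto the enveloping algebra. -/
def envelopingMk (b : V → V → V) :
    BialgCat.of k (TensorAlgebra k V) ⟶ envelopingBialgebra k b :=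
  quotientByPrimitivesMk (lieRelations k b) (lieRelations_subset k b)

/-- The restricted enveloping algebra `TV / (xy - yx - [x,y], x ^ p - x^[p])`, with the quotient
bialgebra structure. -/
def restrictedEnvelopingBialgebra (p : ℕ) [Fact p.Prime] [CharP k p] (b : V → V → V)
    (q : V → V) : BialgCat.{u} k :=
  quotientByPrimitives (lieRelations k b ∪ powerRelations k p q)
    (restrictedRelations_subset k p b q)

/-- The projection of `TV` onto the restricted enveloping algebra. -/
def restrictedEnvelopingMk (p : ℕ) [Fact p.Prime] [CharP k p] (b : V → V → V) (q : V → V) :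
    BialgCat.of k (TensorAlgebra k V) ⟶ restrictedEnvelopingBialgebra k p b q :=
  quotientByPrimitivesMk (lieRelations k b ∪ powerRelations k p q)
    (restrictedRelations_subset k p b q)

end Lie

end

/-!
Everything rests on one fact about primitive elements, `primitives_le_of_adjoin_eq_top`: if a
bialgebra is generated as an algebra by a space `g` of primitive elements that is closed under
commutators and, in characteristic `p > 0`, under `p`-th powers, then every primitive element lies
in `g`. This replaces the Poincaré-Birkhoff-Witt theorem and its restricted analogue. Filter the
algebra by the length of products of elements of `g`; the associated graded algebra is commutative.
For a linear functional `φ` vanishing at `1`, the operator `(φ ⊗ id) ∘ Δ` acts on it as the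
derivation extending `φ`, so that for a basis `bᵢ` of `g` with dual functionals `φᵢ` the operators
`bᵢ · (φᵢ ⊗ id) ∘ Δ` are diagonal on monomials, the eigenvalues being the exponents. They annihilate
the leading term of a primitive element of order `≥ 2`, which is therefore a combination of
monomials whose exponents vanish in `k`. In characteristic zero there are none; in characteristic
`p` such a monomial contains some `bᵢ ^ p ∈ g` and is of lower order. Hence primitive elements have
order at most one.

Consequently every primitive element of a quotient bialgebra of `TV` lifts to a primitive element of
`TV` (`exists_primitive_lift`), and `P(TV)` is obtained from `V` by linear combinations, commutators
and `p`-th powers.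

The quotient of `TV₀` by `Im (Id - η₀ ∘ μ₀)` has the universal property of `L₁ (V₀, μ₀)`, because a
linear map `V₀ → P(A)` is a morphism of algebras over the monad `PT` exactly when its extension to
`TV₀` kills these elements (`algebraHom_iff`). By the lifting property the unit
`V₀ → P(L₁ (V₀, μ₀))` is surjective, so `L₁` sends the unit to epimorphisms and `L₁ ⊣ R₁` is
idempotent. For an idempotent adjunction, algebras over the monad are objects on which the unit is
invertible: a left adjoint of the next comparison functor is obtained by forgetting the structure
and applying `L₁`, and its unit is invertible, so that it is full and faithful.

Finally `μ₀ : P(TV₀) → V₀` is surjective and, by its associativity, carries commutators and `p`-th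
powers to the induced bracket and `p`-operation. The axioms of a (restricted) Lie algebra are thus
inherited from the commutator and the `p`-th power in the associative algebra `TV₀`, where they come
down to Jacobson's formula, `add_pow_char_eq_sum_adCoeff`. The elements `z` of `P(TV₀)` that agree
with `μ₀ z` modulo the defining relations of the (restricted) enveloping algebra are closed under
commutators and `p`-th powers, so they are all of `P(TV₀)`, and the two ideals coincide.
-/

/-! ### Algebras filtered by the length of products -/

section Filtration

variable (k : Type u) [Field k] {A : Type u} [Ring A] [Algebra k A]

/-- The span of all products of fewer than `n` elements of `g`, so that the elements of order at
most `n` form `monomialFiltration k g (n + 1)`. Counting with a strict inequality makes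
`monomialFiltration k g 0` vanish, which lets error terms be tracked without case splits. -/
def monomialFiltration (g : Submodule k A) (n : ℕ) : Submodule k A :=
  Submodule.span k {a | ∃ l : List A, (∀ x ∈ l, x ∈ g) ∧ l.length < n ∧ l.prod = a}

variable {k} {g : Submodule k A}

lemma prod_mem_monomialFiltration {l : List A} (hl : ∀ x ∈ l, x ∈ g) {n : ℕ} (hn : l.length < n) :
    l.prod ∈ monomialFiltration k g n :=
  Submodule.subset_span ⟨l, hl, hn, rfl⟩

lemma monomialFiltration_mono {m n : ℕ} (h : m ≤ n) :
    monomialFiltration k g m ≤ monomialFiltration k g n :=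
  Submodule.span_mono fun _ ⟨l, hl, hm, e⟩ => ⟨l, hl, hm.trans_le h, e⟩

lemma one_mem_monomialFiltration (n : ℕ) : (1 : A) ∈ monomialFiltration k g (n + 1) := by
  have := prod_mem_monomialFiltration (k := k) (g := g) (l := []) (by simp) (Nat.succ_pos n)
  simpa using this

lemma mem_monomialFiltration_two {x : A} (hx : x ∈ g) : x ∈ monomialFiltration k g 2 := by
  have := prod_mem_monomialFiltration (k := k) (g := g) (l := [x]) (by simpa using hx)
    (n := 2) (by simp)
  simpa using this

lemma mul_mem_monomialFiltration {x a : A} (hx : x ∈ g) {n : ℕ}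
    (ha : a ∈ monomialFiltration k g n) : x * a ∈ monomialFiltration k g (n + 1) := by
  induction ha using Submodule.span_induction with
  | mem a ha =>
    obtain ⟨l, hl, hn, rfl⟩ := ha
    rw [← List.prod_cons]
    exact prod_mem_monomialFiltration (by simpa using ⟨hx, hl⟩) (by simpa using hn)
  | zero => simp
  | add a b _ _ ha hb => rw [mul_add]; exact add_mem ha hb
  | smul c a _ ha => rw [mul_smul_comm]; exact Submodule.smul_mem _ _ ha

lemma exists_mem_monomialFiltration {a : A} (ha : a ∈ Algebra.adjoin k (g : Set A)) :
    ∃ n, a ∈ monomialFiltration k g n := by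
  rw [← Subalgebra.mem_toSubmodule, Algebra.adjoin_eq_span] at ha
  induction ha using Submodule.span_induction with
  | mem a ha =>
    obtain ⟨l, hl, rfl⟩ := Submonoid.exists_list_of_mem_closure ha
    exact ⟨_, prod_mem_monomialFiltration hl (Nat.lt_succ_self _)⟩
  | zero => exact ⟨0, zero_mem _⟩
  | add a b _ _ ha hb =>
    obtain ⟨m, hm⟩ := ha
    obtain ⟨n, hn⟩ := hb
    exact ⟨max m n, add_mem (monomialFiltration_mono (le_max_left _ _) hm)
      (monomialFiltration_mono (le_max_right _ _) hn)⟩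
  | smul c a _ ha =>
    obtain ⟨m, hm⟩ := ha
    exact ⟨m, Submodule.smul_mem _ _ hm⟩

/-- The associated graded of the filtration is commutative. -/
lemma prod_sub_prod_mem_of_perm (hcomm : ∀ x ∈ g, ∀ y ∈ g, x * y - y * x ∈ g) {l l' : List A}
    (h : l.Perm l') (hl : ∀ x ∈ l, x ∈ g) :
    l.prod - l'.prod ∈ monomialFiltration k g l.length := by
  induction h with
  | nil => simp
  | @cons x l l' _ ih =>
    simp only [List.mem_cons, forall_eq_or_imp] at hl
    rw [List.prod_cons, List.prod_cons, ← mul_sub]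
    exact mul_mem_monomialFiltration hl.1 (ih hl.2)
  | swap x y l =>
    simp only [List.mem_cons, forall_eq_or_imp] at hl
    have : (y :: x :: l).prod - (x :: y :: l).prod = (y * x - x * y) * l.prod := by
      simp [sub_mul, mul_assoc]
    rw [this]
    exact mul_mem_monomialFiltration (hcomm _ hl.1 _ hl.2.1)
      (prod_mem_monomialFiltration hl.2.2 (Nat.lt_succ_self _))
  | trans h₁ _ ih₁ ih₂ =>
    rw [← sub_add_sub_cancel]
    refine add_mem (ih₁ hl) ?_
    rw [h₁.length_eq]
    exact ih₂ fun x hx => hl x (h₁.mem_iff.2 hx)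

/-- Multilinear expansion of a product in a basis of `g`. -/
lemma prod_mem_span_basis {ι : Type*} (b : Module.Basis ι k g) (l : List A)
    (hl : ∀ x ∈ l, x ∈ g) :
    l.prod ∈ Submodule.span k {a | ∃ m : List ι, m.length = l.length ∧
      (m.map fun i => (b i : A)).prod = a} := by
  induction l with
  | nil => exact Submodule.subset_span ⟨[], rfl, by simp⟩
  | cons x l ih =>
    simp only [List.mem_cons, forall_eq_or_imp] at hl
    have hx : x ∈ Submodule.span k (Set.range fun i => (b i : A)) := by
      have h := Submodule.mem_map_of_mem (f := g.subtype) (b.mem_span ⟨x, hl.1⟩)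
      rw [Submodule.map_span, ← Set.range_comp] at h
      exact h
    have := Submodule.mul_mem_mul hx (ih hl.2)
    rw [Submodule.span_mul_span] at this
    rw [List.prod_cons]
    refine Submodule.span_mono ?_ this
    rintro _ ⟨_, ⟨i, rfl⟩, _, ⟨m, hm, rfl⟩, rfl⟩
    exact ⟨i :: m, by simp [hm], by simp⟩

lemma monomialFiltration_succ_le {ι : Type*} (b : Module.Basis ι k g) (n : ℕ) :
    monomialFiltration k g (n + 1) ≤
      Submodule.span k ((fun m : List ι => (m.map fun i => (b i : A)).prod) ''
        {m | m.length = n}) ⊔ monomialFiltration k g n := by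
  refine Submodule.span_le.2 ?_
  rintro _ ⟨l, hl, hn, rfl⟩
  rcases Nat.lt_succ_iff_lt_or_eq.1 hn with h | rfl
  · exact Submodule.mem_sup_right (prod_mem_monomialFiltration hl h)
  · refine Submodule.mem_sup_left (Submodule.span_mono ?_ (prod_mem_span_basis b l hl))
    rintro _ ⟨m, hm, rfl⟩
    exact ⟨m, hm, rfl⟩

end Filtration

/-! ### Primitive elements of primitively generated bialgebras -/

section Contraction

variable {k : Type u} [Field k] {A : Type u} [Ring A] [Bialgebra k A] {g : Submodule k A}

/-- The operator `(φ ⊗ id) ∘ Δ` attached to a linear functional `φ`. On products of primitive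
elements it acts, up to terms of lower order, as the derivation extending `φ`. -/
noncomputable def contraction (φ : A →ₗ[k] k) : A →ₗ[k] A :=
  (TensorProduct.lid k A).toLinearMap ∘ₗ φ.rTensor A ∘ₗ Coalgebra.comul

@[simp] lemma contraction_one (φ : A →ₗ[k] k) : contraction φ 1 = φ 1 • 1 := by
  simp [contraction, Algebra.TensorProduct.one_def]

lemma contraction_of_mem_primitives (φ : A →ₗ[k] k) {a : A} (ha : a ∈ primitives k A) :
    contraction φ a = φ a • 1 + φ 1 • a := by
  simp [contraction, mem_primitives.1 ha]

lemma contraction_mul (φ : A →ₗ[k] k) {x : A} (hx : x ∈ primitives k A) (a : A) :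
    contraction φ (x * a) =
      contraction (φ ∘ₗ LinearMap.mulLeft k x) a + x * contraction φ a := by
  have key : ∀ t : A ⊗[k] A, TensorProduct.lid k A (φ.rTensor A
      ((x ⊗ₜ[k] (1 : A) + (1 : A) ⊗ₜ[k] x) * t)) =
      TensorProduct.lid k A ((φ ∘ₗ LinearMap.mulLeft k x).rTensor A t) +
        x * TensorProduct.lid k A (φ.rTensor A t) := by
    intro t
    induction t with
    | zero => simp
    | tmul a b => simp [add_mul]
    | add s t hs ht =>
      simp only [mul_add, map_add, hs, ht]
      abel
  simp only [contraction, LinearMap.comp_apply, Bialgebra.comul_mul, mem_primitives.1 hx]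
  exact key _

lemma contraction_prod_mem (hg : g ≤ primitives k A) (φ : A →ₗ[k] k) (l : List A)
    (hl : ∀ x ∈ l, x ∈ g) : contraction φ l.prod ∈ monomialFiltration k g (l.length + 1) := by
  induction l generalizing φ with
  | nil =>
    simpa using Submodule.smul_mem _ (φ 1) (one_mem_monomialFiltration (k := k) (g := g) 0)
  | cons x l ih =>
    simp only [List.mem_cons, forall_eq_or_imp] at hl
    rw [List.prod_cons, contraction_mul φ (hg hl.1)]
    exact add_mem (monomialFiltration_mono (Nat.le_succ _) (ih _ hl.2))
      (mul_mem_monomialFiltration hl.1 (ih _ hl.2))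

lemma contraction_prod_mem_of_one (hg : g ≤ primitives k A) {φ : A →ₗ[k] k} (hφ : φ 1 = 0)
    (l : List A) (hl : ∀ x ∈ l, x ∈ g) :
    contraction φ l.prod ∈ monomialFiltration k g l.length := by
  induction l with
  | nil => simp [hφ]
  | cons x l ih =>
    simp only [List.mem_cons, forall_eq_or_imp] at hl
    rw [List.prod_cons, contraction_mul φ (hg hl.1)]
    exact add_mem (contraction_prod_mem hg _ _ hl.2) (mul_mem_monomialFiltration hl.1 (ih hl.2))

/-- `contraction (φ ∘ (x · -))` agrees with multiplication by `φ x` up to lower order terms, since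
contracting with the counit is the identity. -/
lemma contraction_comp_mulLeft_sub_mem (hg : g ≤ primitives k A) (φ : A →ₗ[k] k) (x : A)
    (l : List A) (hl : ∀ x ∈ l, x ∈ g) :
    contraction (φ ∘ₗ LinearMap.mulLeft k x) l.prod - φ x • l.prod ∈
      monomialFiltration k g l.length := by
  have h : contraction (Coalgebra.counit (R := k) (A := A)) l.prod = l.prod := by
    simp [contraction, Coalgebra.rTensor_counit_comul]
  have := contraction_prod_mem_of_one hg
    (φ := φ ∘ₗ LinearMap.mulLeft k x - φ x • Coalgebra.counit (R := k) (A := A)) (by simp) l hl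
  have e : contraction (φ ∘ₗ LinearMap.mulLeft k x - φ x • Coalgebra.counit (R := k) (A := A)) =
      contraction (φ ∘ₗ LinearMap.mulLeft k x) -
        φ x • contraction (Coalgebra.counit (R := k) (A := A)) := by
    simp [contraction, LinearMap.rTensor_sub, LinearMap.rTensor_smul, LinearMap.sub_comp,
      LinearMap.comp_sub, LinearMap.smul_comp, LinearMap.comp_smul]
  rw [e] at this
  simpa [h] using this

variable {ι : Type*} (b : Module.Basis ι k g)

/-- In the associated graded, `b i * contraction φ` is `xᵢ ∂/∂xᵢ`: monomials are eigenvectors,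
with eigenvalue the exponent of `b i`. -/
lemma basis_mul_contraction_sub_mem [DecidableEq ι] (hg : g ≤ primitives k A)
    (hcomm : ∀ x ∈ g, ∀ y ∈ g, x * y - y * x ∈ g) {i : ι} {φ : A →ₗ[k] k} (h1 : φ 1 = 0)
    (hφ : ∀ j, φ (b j) = if j = i then 1 else 0) (m : List ι) :
    (b i : A) * contraction φ (m.map fun i => (b i : A)).prod -
      (m.count i : k) • (m.map fun i => (b i : A)).prod ∈ monomialFiltration k g m.length := by
  induction m with
  | nil => simp [h1]
  | cons j m ih =>
    set w := (m.map fun i => (b i : A)).prod with hw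
    have hm : ∀ x ∈ m.map fun i => (b i : A), x ∈ g := by
      intro x hx
      obtain ⟨i, -, rfl⟩ := List.mem_map.1 hx
      exact (b i).2
    have h₂ := contraction_comp_mulLeft_sub_mem hg φ (b j : A) _ hm
    have h₃ := contraction_prod_mem_of_one hg h1 _ hm
    rw [List.length_map, ← hw] at h₂ h₃
    have key : (b i : A) * contraction φ (b j * w) - (((j :: m).count i : ℕ) : k) • (b j * w) =
        (b i : A) * (contraction (φ ∘ₗ LinearMap.mulLeft k (b j : A)) w - φ (b j) • w) +
          ((b i : A) * b j - b j * b i) * contraction φ w +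
          (b j : A) * (b i * contraction φ w - (m.count i : k) • w) := by
      rw [contraction_mul φ (hg (b j).2), List.count_cons, hφ]
      by_cases hij : j = i
      · subst hij
        simp only [beq_self_eq_true, if_true, Nat.cast_add, Nat.cast_one, add_smul, one_smul,
          mul_smul_comm, mul_add, mul_sub, sub_mul, mul_assoc]
        abel
      · simp only [beq_iff_eq, if_neg hij, add_zero, zero_smul,
          mul_smul_comm, mul_add, mul_sub, sub_mul, mul_assoc, sub_zero]
        abel
    rw [List.map_cons, List.prod_cons, ← hw, key, List.length_cons]
    exact add_mem (add_mem (mul_mem_monomialFiltration (b i).2 h₂)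
      (mul_mem_monomialFiltration (hcomm _ (b i).2 _ (b j).2) h₃))
      (mul_mem_monomialFiltration (b j).2 ih)

lemma basis_mul_contraction_mem (hg : g ≤ primitives k A) {φ : A →ₗ[k] k} (h1 : φ 1 = 0) (i : ι)
    {n : ℕ} {a : A} (ha : a ∈ monomialFiltration k g n) :
    (b i : A) * contraction φ a ∈ monomialFiltration k g n := by
  induction ha using Submodule.span_induction with
  | mem a ha =>
    obtain ⟨l, hl, hn, rfl⟩ := ha
    exact monomialFiltration_mono hn
      (mul_mem_monomialFiltration (b i).2 (contraction_prod_mem_of_one hg h1 l hl))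
  | zero => simp
  | add a b _ _ ha hb => rw [map_add, mul_add]; exact add_mem ha hb
  | smul c a _ ha => rw [map_smul, mul_smul_comm]; exact Submodule.smul_mem _ _ ha

/-- A functional on the bialgebra dual to a basis of `g` and vanishing at `1`: the counit
separates `1` from the primitive elements. -/
lemma exists_dual_functional [DecidableEq ι] (hg : g ≤ primitives k A) (i : ι) :
    ∃ φ : A →ₗ[k] k, φ 1 = 0 ∧ ∀ j, φ (b j) = if j = i then 1 else 0 := by
  obtain ⟨f, hf⟩ := LinearMap.exists_extend (b.coord i)
  refine ⟨f - f 1 • Coalgebra.counit (R := k) (A := A), by simp, fun j => ?_⟩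
  have h := LinearMap.congr_fun hf (b j)
  simp only [LinearMap.comp_apply, Submodule.subtype_apply, Module.Basis.coord_apply,
    Module.Basis.repr_self, Finsupp.single_apply] at h
  simp [h, counit_of_mem_primitives (hg (b j).2)]

/-- Removing one nonzero eigenvalue: if `E` acts on the `w m` by scalars `c m` modulo an
invariant subspace `N`, and `E a` vanishes modulo `N`, then `a` needs no `w m` with `c m = r`. -/
lemma mem_span_sup_of_eigen {M β : Type*} [AddCommGroup M] [Module k M] {N : Submodule k M}
    {E : M →ₗ[k] M} (hN : ∀ x ∈ N, E x ∈ N) {W : Set β} {w : β → M} {c : β → k}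
    (hw : ∀ m ∈ W, E (w m) - c m • w m ∈ N) {r : k} (hr : r ≠ 0) {a : M} (hE : E a ∈ N)
    (ha : a ∈ Submodule.span k (w '' W) ⊔ N) :
    a ∈ Submodule.span k (w '' {m ∈ W | c m ≠ r}) ⊔ N := by
  have hT : Submodule.span k (w '' W) ⊔ N ≤
      (Submodule.span k (w '' {m ∈ W | c m ≠ r}) ⊔ N).comap (LinearMap.id - r⁻¹ • E) := by
    refine sup_le (Submodule.span_le.2 ?_) fun x hx => ?_
    · rintro _ ⟨m, hm, rfl⟩
      have e : w m - r⁻¹ • E (w m) =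
          (1 - r⁻¹ * c m) • w m - r⁻¹ • (E (w m) - c m • w m) := by
        rw [sub_smul, one_smul, smul_sub, smul_smul]
        abel
      rw [SetLike.mem_coe, Submodule.mem_comap, LinearMap.sub_apply, LinearMap.id_apply,
        LinearMap.smul_apply, e]
      refine sub_mem ?_ (Submodule.mem_sup_right (Submodule.smul_mem _ _ (hw m hm)))
      by_cases hc : c m = r
      · simp [hc, hr]
      · exact Submodule.mem_sup_left (Submodule.smul_mem _ _
          (Submodule.subset_span ⟨m, ⟨hm, hc⟩, rfl⟩))
    · exact Submodule.mem_sup_right (sub_mem hx (Submodule.smul_mem _ _ (hN x hx)))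
  have h := hT ha
  have e : a = (LinearMap.id - r⁻¹ • E : M →ₗ[k] M) a + r⁻¹ • E a := by simp
  rw [e]
  exact add_mem h (Submodule.mem_sup_right (Submodule.smul_mem _ _ hE))

/-- A monomial all of whose exponents vanish in `k` is of lower order: in characteristic zero there
is none, and in characteristic `p` some `b i` occurs `p` times, so that `(b i) ^ p ∈ g` shortens
the product. -/
lemma basis_prod_mem_of_count_eq_zero [DecidableEq ι]
    (hcomm : ∀ x ∈ g, ∀ y ∈ g, x * y - y * x ∈ g)
    (hpow : ∀ q : ℕ, q.Prime → (q : k) = 0 → ∀ x ∈ g, x ^ q ∈ g) {m : List ι} (hm : m ≠ [])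
    (hc : ∀ i ∈ m, (m.count i : k) = 0) :
    (m.map fun i => (b i : A)).prod ∈ monomialFiltration k g m.length := by
  obtain ⟨i, hi⟩ := List.exists_mem_of_ne_nil m hm
  obtain ⟨q, hq⟩ := CharP.exists k
  have hdvd : q ∣ m.count i := (CharP.cast_eq_zero_iff k q _).1 (hc i hi)
  have hpos : 0 < m.count i := List.count_pos_iff.2 hi
  have hprime : q.Prime := by
    rcases CharP.char_is_prime_or_zero k q with h | rfl
    · exact h
    · exact absurd (zero_dvd_iff.1 hdvd) hpos.ne'
  have hle : q ≤ m.count i := Nat.le_of_dvd hpos hdvd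
  obtain ⟨m', hm'⟩ := (List.replicate_sublist_iff.2 hle).exists_perm_append
  have hmem : ∀ m : List ι, ∀ x ∈ m.map fun i => (b i : A), x ∈ g := by
    intro m x hx
    obtain ⟨i, -, rfl⟩ := List.mem_map.1 hx
    exact (b i).2
  have h₁ := prod_sub_prod_mem_of_perm (k := k) hcomm (hm'.map fun i => (b i : A)) (hmem m)
  rw [List.length_map] at h₁
  rw [← sub_add_cancel (m.map fun i => (b i : A)).prod
    ((List.replicate q i ++ m').map fun i => (b i : A)).prod]
  refine add_mem h₁ ?_
  rw [List.map_append, List.prod_append, List.map_replicate, List.prod_replicate, ← List.prod_cons]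
  refine prod_mem_monomialFiltration ?_ ?_
  · simp only [List.mem_cons, forall_eq_or_imp]
    exact ⟨hpow q hprime (CharP.cast_eq_zero k q) _ (b i).2, hmem m'⟩
  · rw [hm'.length_eq, List.length_append, List.length_replicate, List.length_cons,
      List.length_map]
    have := hprime.two_le
    omega

/-- A primitive element of order at least two has vanishing leading term. -/
lemma mem_monomialFiltration_of_mem_primitives (hg : g ≤ primitives k A)
    (hcomm : ∀ x ∈ g, ∀ y ∈ g, x * y - y * x ∈ g)
    (hpow : ∀ q : ℕ, q.Prime → (q : k) = 0 → ∀ x ∈ g, x ^ q ∈ g) {n : ℕ} (hn : 2 ≤ n) {a : A}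
    (ha : a ∈ primitives k A) (han : a ∈ monomialFiltration k g (n + 1)) :
    a ∈ monomialFiltration k g n := by
  classical
  obtain ⟨ι, ⟨b⟩⟩ : ∃ ι : Type u, Nonempty (Module.Basis ι k g) :=
    ⟨_, ⟨Module.Basis.ofVectorSpace k g⟩⟩
  let w : List ι → A := fun m => (m.map fun i => (b i : A)).prod
  obtain ⟨u, hu, v, hv, rfl⟩ := Submodule.mem_sup.1 (monomialFiltration_succ_le b n han)
  obtain ⟨F, hF, huF⟩ := Submodule.mem_span_finite_of_mem_span hu
  obtain ⟨L, hL, rfl⟩ := Finset.subset_set_image_iff.1 hF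
  choose φ hφ1 hφ using exists_dual_functional b hg
  -- A pair `(i, r)` in `s` with `r ≠ 0` stands for the eigenvalue `r` of the operator
  -- `b i * contraction (φ i)`, which annihilates `u + v` modulo lower order.
  have key : ∀ s : Finset (ι × k),
      u + v ∈ Submodule.span k (w '' {m | m ∈ L ∧ ∀ x ∈ s, x.2 ≠ 0 → (m.count x.1 : k) ≠ x.2}) ⊔
        monomialFiltration k g n := by
    intro s
    induction s using Finset.induction_on with
    | empty =>
      refine add_mem (Submodule.mem_sup_left ?_) (Submodule.mem_sup_right hv)
      rw [Finset.coe_image] at huF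
      refine Submodule.span_mono (Set.image_mono fun m hm => ?_) huF
      exact ⟨hm, by simp⟩
    | insert x s _ ih =>
      by_cases hx : x.2 = 0
      · refine SetLike.le_def.1 (sup_le_sup_right (Submodule.span_mono (Set.image_mono ?_)) _) ih
        rintro m ⟨hm, h⟩
        refine ⟨hm, fun y hy => ?_⟩
        rcases Finset.mem_insert.1 hy with rfl | hy
        · exact fun h => absurd hx h
        · exact h y hy
      · have := mem_span_sup_of_eigen (N := monomialFiltration k g n)
          (E := LinearMap.mulLeft k (b x.1 : A) ∘ₗ contraction (φ x.1))
          (c := fun m => (m.count x.1 : k))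
          (fun y hy => basis_mul_contraction_mem b hg (hφ1 _) _ hy) ?_ hx ?_ ih
        · refine SetLike.le_def.1 (sup_le_sup_right (Submodule.span_mono (Set.image_mono ?_)) _)
            this
          rintro m ⟨⟨hm, h⟩, h'⟩
          refine ⟨hm, fun y hy hy0 => ?_⟩
          rcases Finset.mem_insert.1 hy with rfl | hy
          · exact h'
          · exact h y hy hy0
        · rintro m ⟨hm, -⟩
          have hmn : m.length = n := hL hm
          rw [← hmn]
          exact basis_mul_contraction_sub_mem b hg hcomm (hφ1 _) (hφ _) m
        · rw [LinearMap.comp_apply, contraction_of_mem_primitives _ ha, hφ1, zero_smul, add_zero,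
            map_smul, LinearMap.mulLeft_apply, mul_one]
          exact Submodule.smul_mem _ _ (monomialFiltration_mono hn
            (mem_monomialFiltration_two (b x.1).2))
  -- Only the finitely many exponents occurring in monomials of `L` have to be excluded.
  have hfin := key (L.biUnion fun m => m.toFinset.image fun i => (i, (m.count i : k)))
  refine SetLike.le_def.1 (sup_le (Submodule.span_le.2 ?_) le_rfl) hfin
  rintro _ ⟨m, ⟨hm, h⟩, rfl⟩
  have hmn : m.length = n := hL hm
  have hc : ∀ i ∈ m, (m.count i : k) = 0 := by
    intro i hi
    by_contra h0
    refine h (i, (m.count i : k)) ?_ h0 rfl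
    exact Finset.mem_biUnion.2 ⟨m, hm, Finset.mem_image.2 ⟨i, List.mem_toFinset.2 hi, rfl⟩⟩
  have := basis_prod_mem_of_count_eq_zero b hcomm hpow (m := m)
    (by rintro rfl; simp at hmn; omega) hc
  rwa [hmn] at this

/-- If a bialgebra is generated as an algebra by a space of primitive elements that is closed under
commutators, and under `p`-th powers in characteristic `p > 0`, then there are no further primitive
elements. -/
theorem primitives_le_of_adjoin_eq_top (hg : g ≤ primitives k A)
    (hcomm : ∀ x ∈ g, ∀ y ∈ g, x * y - y * x ∈ g)
    (hpow : ∀ q : ℕ, q.Prime → (q : k) = 0 → ∀ x ∈ g, x ^ q ∈ g)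
    (htop : Algebra.adjoin k (g : Set A) = ⊤) : primitives k A ≤ g := by
  intro a ha
  have h2 : ∀ n, a ∈ monomialFiltration k g (n + 2) → a ∈ monomialFiltration k g 2 := by
    intro n
    induction n with
    | zero => exact id
    | succ n ih =>
      exact fun h => ih (mem_monomialFiltration_of_mem_primitives hg hcomm hpow (by omega) ha h)
  obtain ⟨n, hn⟩ := exists_mem_monomialFiltration (k := k) (g := g) (a := a)
    (by rw [htop]; exact Algebra.mem_top)
  have h := h2 n (monomialFiltration_mono (Nat.le_add_right _ _) hn)
  have hle : monomialFiltration k g 2 ≤ Submodule.span k {1} ⊔ g := by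
    refine Submodule.span_le.2 ?_
    rintro _ ⟨l, hl, hlen, rfl⟩
    match l, hl, hlen with
    | [], _, _ => exact Submodule.mem_sup_left (Submodule.mem_span_singleton_self _)
    | [x], hl, _ => exact Submodule.mem_sup_right (by simpa using hl)
  obtain ⟨y, hy, x, hx, rfl⟩ := Submodule.mem_sup.1 (hle h)
  obtain ⟨c, rfl⟩ := Submodule.mem_span_singleton.1 hy
  have hε := counit_of_mem_primitives ha
  rw [map_add, map_smul, Bialgebra.counit_one, counit_of_mem_primitives (hg hx)] at hε
  have hc : c = 0 := by simpa using hε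
  simpa [hc] using hx

end Contraction

/-! ### Jacobson's formula -/

section Jacobson

lemma natCast_choose_pred_of_charP (p : ℕ) [Fact p.Prime] {R : Type*} [Ring R] [CharP R p]
    {i : ℕ} (hi : i < p) : (((p - 1).choose i : ℕ) : R) = (-1) ^ i := by
  induction i with
  | zero => simp
  | succ i ih =>
    have hp : p - 1 + 1 = p := Nat.sub_add_cancel (Fact.out : p.Prime).one_le
    have h := Nat.choose_succ_succ (p - 1) i
    rw [Nat.succ_eq_add_one, hp] at h
    have h0 : ((p.choose (i + 1) : ℕ) : R) = 0 :=
      (CharP.cast_eq_zero_iff R p _).2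
        ((Fact.out : p.Prime).dvd_choose_self (Nat.succ_ne_zero _) hi)
    rw [h, Nat.cast_add, ih (Nat.lt_of_succ_lt hi)] at h0
    rw [pow_succ, mul_neg_one]
    exact eq_neg_of_add_eq_zero_right h0

lemma Commute.sub_pow_pred_char (p : ℕ) [Fact p.Prime] {R : Type*} [Ring R] [CharP R p]
    {x y : R} (h : Commute x y) :
    (x - y) ^ (p - 1) = ∑ i ∈ Finset.range p, x ^ i * y ^ (p - 1 - i) := by
  have hp : p - 1 + 1 = p := Nat.sub_add_cancel (Fact.out : p.Prime).one_le
  have hp1 : (-1 : R) ^ (p - 1) = 1 := by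
    rw [← natCast_choose_pred_of_charP p (R := R) (i := p - 1) (by omega)]
    simp
  rw [sub_eq_add_neg, h.neg_right.add_pow, hp]
  refine Finset.sum_congr rfl fun i hi => ?_
  have hi' := Finset.mem_range.1 hi
  have hprod : (-1 : R) ^ i * (-1) ^ (p - 1 - i) = 1 := by
    rw [← pow_add, Nat.add_sub_cancel' (by omega), hp1]
  rw [natCast_choose_pred_of_charP p hi', neg_pow y]
  rcases neg_one_pow_eq_or R i with h1 | h1
  · rw [h1, one_mul] at hprod
    rw [h1, hprod, one_mul, mul_one]
  · rw [h1, neg_one_mul, neg_eq_iff_eq_neg] at hprod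
    simp [h1, hprod]

variable (k : Type u) [Field k] {A : Type u} [Ring A] [Algebra k A]

lemma ad_pow_char (p : ℕ) [Fact p.Prime] [CharP k p] (u : A) :
    (LinearMap.mulLeft k u - LinearMap.mulRight k u) ^ p =
      LinearMap.mulLeft k (u ^ p) - LinearMap.mulRight k (u ^ p) := by
  rcases subsingleton_or_nontrivial A with h | h
  · exact LinearMap.ext fun _ => Subsingleton.elim _ _
  · have : CharP (Module.End k A) p := charP_of_injective_algebraMap' k p
    rw [sub_pow_char_of_commute p (LinearMap.commute_mulLeft_right (R := k) u u),
      LinearMap.pow_mulLeft, LinearMap.pow_mulRight]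

lemma sum_pow_mul_mul_pow_of_charP (p : ℕ) [Fact p.Prime] [CharP k p] (u v : A) :
    ∑ i ∈ Finset.range p, u ^ i * v * u ^ (p - 1 - i) =
      ((LinearMap.mulLeft k u - LinearMap.mulRight k u) ^ (p - 1)) v := by
  rcases subsingleton_or_nontrivial A with h | h
  · exact Subsingleton.elim _ _
  · have : CharP (Module.End k A) p := charP_of_injective_algebraMap' k p
    rw [(LinearMap.commute_mulLeft_right (R := k) u u).sub_pow_pred_char p, LinearMap.sum_apply]
    refine Finset.sum_congr rfl fun i _ => ?_
    rw [LinearMap.pow_mulLeft, LinearMap.pow_mulRight, Module.End.mul_apply,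
      LinearMap.mulLeft_apply, LinearMap.mulRight_apply, mul_assoc]

/-- The Leibniz rule for a power of a polynomial with noncommuting coefficients. -/
lemma derivative_pow_eq_sum {R : Type*} [Semiring R] (u : Polynomial R) (n : ℕ) :
    Polynomial.derivative (u ^ n) =
      ∑ i ∈ Finset.range n, u ^ i * Polynomial.derivative u * u ^ (n - 1 - i) := by
  induction n with
  | zero => simp
  | succ n ih =>
    rw [pow_succ, Polynomial.derivative_mul, ih, Finset.sum_range_succ, Finset.sum_mul]
    congr 1
    · refine Finset.sum_congr rfl fun i hi => ?_
      have := Finset.mem_range.1 hi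
      rw [mul_assoc _ _ u, ← pow_succ]
      congr 2
      omega
    · simp

open Polynomial in
/-- `adCoeff` for the commutator consists of the coefficients of `(ad (t x + y)) ^ m (x)`. -/
lemma coeff_ad_pow_eq_adCoeff (x y : A) (m j : ℕ) :
    (((LinearMap.mulLeft k (C x * X + C y) - LinearMap.mulRight k (C x * X + C y) :
      Module.End k A[X]) ^ m) (C x)).coeff j = adCoeff (fun a b : A => a * b - b * a) x y m j := by
  induction m generalizing j with
  | zero => cases j <;> simp [adCoeff, coeff_C]
  | succ m ih =>
    rw [pow_succ', Module.End.mul_apply]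
    set w := ((LinearMap.mulLeft k (C x * X + C y) -
      LinearMap.mulRight k (C x * X + C y) : Module.End k A[X]) ^ m) (C x)
    have e : (LinearMap.mulLeft k (C x * X + C y) - LinearMap.mulRight k (C x * X + C y) :
        Module.End k A[X]) w =
        (C x * w - w * C x) * X + (C y * w - w * C y) := by
      simp only [LinearMap.sub_apply, LinearMap.mulLeft_apply, LinearMap.mulRight_apply, add_mul,
        mul_add, sub_mul, mul_assoc, X_mul]
      abel
    rw [e]
    cases j with
    | zero => simp [adCoeff, ← ih]
    | succ j => simp [adCoeff, ← ih]

open Polynomial in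
/-- Jacobson's formula for `(x + y) ^ p`, read off from the coefficients of `(t x + y) ^ p`: its
derivative with respect to `t` is `(ad (t x + y)) ^ (p - 1) (x)`. -/
theorem add_pow_char_eq_sum_adCoeff (p : ℕ) [Fact p.Prime] [CharP k p] (x y : A) :
    (x + y) ^ p = x ^ p + y ^ p + ∑ i ∈ Finset.Icc 1 (p - 1),
      (i : k)⁻¹ • adCoeff (fun a b : A => a * b - b * a) x y (p - 1) (i - 1) := by
  have hp : 2 ≤ p := (Fact.out : p.Prime).two_le
  set u : A[X] := C x * X + C y with hu
  have hdeg : u.natDegree ≤ 1 := natDegree_linear_le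
  have hu' : derivative u = C x := by simp [hu]
  have hcoeff : ∀ i ∈ Finset.Icc 1 (p - 1), (u ^ p).coeff i =
      (i : k)⁻¹ • adCoeff (fun a b : A => a * b - b * a) x y (p - 1) (i - 1) := by
    intro i hi
    obtain ⟨hi1, hi2⟩ := Finset.mem_Icc.1 hi
    obtain ⟨i, rfl⟩ := Nat.exists_eq_add_of_le' hi1
    have h : (derivative (u ^ p)).coeff i =
        adCoeff (fun a b : A => a * b - b * a) x y (p - 1) i := by
      rw [derivative_pow_eq_sum, hu', sum_pow_mul_mul_pow_of_charP k p, coeff_ad_pow_eq_adCoeff]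
    -- The derivative gives `(i + 1)` times the coefficient, and `i + 1 < p` is invertible.
    have hi0 : ((i + 1 : ℕ) : k) ≠ 0 := by
      rw [Ne, CharP.cast_eq_zero_iff k p]
      exact fun hd => absurd (Nat.le_of_dvd (Nat.succ_pos _) hd) (by omega)
    rw [Nat.add_sub_cancel, ← h, coeff_derivative, eq_inv_smul_iff₀ hi0, ← Nat.cast_succ,
      ← nsmul_eq_mul', Nat.cast_smul_eq_nsmul]
  have heval : (x + y) ^ p = (u ^ p).eval 1 := by
    have := map_pow (eval₂RingHom' (RingHom.id A) (1 : A) fun a => Commute.one_right a) u p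
    change (u ^ p).eval 1 = u.eval 1 ^ p at this
    rw [this]
    simp [hu]
  have hnat : (u ^ p).natDegree < p + 1 :=
    Nat.lt_succ_of_le (natDegree_pow_le_of_le p hdeg |>.trans (by simp))
  rw [heval, eval_eq_sum_range' hnat, Finset.sum_range_succ,
    Finset.sum_range_eq_add_Ico _ (by omega)]
  have h0 : (u ^ p).coeff 0 = y ^ p := by
    have := map_pow (constantCoeff (R := A)) u p
    simpa [hu] using this
  have h1 : (u ^ p).coeff p = x ^ p := by
    have := coeff_pow_of_natDegree_le (m := p) hdeg
    rw [mul_one] at this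
    rw [this]
    simp [hu]
  have hIco : Finset.Ico 1 p = Finset.Icc 1 (p - 1) := by
    ext i
    simp only [Finset.mem_Ico, Finset.mem_Icc]
    omega
  rw [h0, h1, hIco, ← Finset.sum_congr rfl hcoeff]
  simp only [one_pow, mul_one]
  abel

end Jacobson

/-! ### Restricted Lie algebras -/

section RestrictedLie

variable {k : Type u} [Field k] {V W : Type u} [AddCommGroup V] [Module k V] [AddCommGroup W]
  [Module k W] {b : V → V → V} {b' : W → W → W}

lemma map_adCoeff (f : V →ₗ[k] W) (hb : ∀ x y, f (b x y) = b' (f x) (f y)) (x y : V) (m j : ℕ) :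
    f (adCoeff b x y m j) = adCoeff b' (f x) (f y) m j := by
  induction m generalizing j with
  | zero => cases j <;> simp [adCoeff]
  | succ m ih => cases j <;> simp [adCoeff, hb, ih]

lemma map_iterate_bracket (f : V →ₗ[k] W) (hb : ∀ x y, f (b x y) = b' (f x) (f y)) (x y : V)
    (n : ℕ) : f ((b x)^[n] y) = (b' (f x))^[n] (f y) := by
  induction n generalizing y with
  | zero => rfl
  | succ n ih => rw [Function.iterate_succ_apply, Function.iterate_succ_apply, ih, hb]

lemma IsLieBracket.of_injective (f : V →ₗ[k] W) (hf : Function.Injective f)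
    (hb : ∀ x y, f (b x y) = b' (f x) (f y)) (h : IsLieBracket k b') : IsLieBracket k b where
  add_left x y z := hf (by simp [hb, h.add_left])
  add_right x y z := hf (by simp [hb, h.add_right])
  smul_left c x y := hf (by simp [hb, h.smul_left])
  smul_right c x y := hf (by simp [hb, h.smul_right])
  self x := hf (by simp [hb, h.self])
  jacobi x y z := hf (by simp [hb, h.jacobi])

lemma IsLieBracket.of_surjective (f : V →ₗ[k] W) (hf : Function.Surjective f)
    (hb : ∀ x y, f (b x y) = b' (f x) (f y)) (h : IsLieBracket k b) : IsLieBracket k b' where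
  add_left := hf.forall₃.2 fun x y z => by simp only [← hb, ← map_add, h.add_left]
  add_right := hf.forall₃.2 fun x y z => by simp only [← hb, ← map_add, h.add_right]
  smul_left c := hf.forall₂.2 fun x y => by simp only [← hb, ← map_smul, h.smul_left]
  smul_right c := hf.forall₂.2 fun x y => by simp only [← hb, ← map_smul, h.smul_right]
  self := hf.forall.2 fun x => by rw [← hb, h.self, map_zero]
  jacobi := hf.forall₃.2 fun x y z => by simp only [← hb, ← map_add, h.jacobi, map_zero]

variable {p : ℕ} {q : V → V} {q' : W → W}

lemma IsRestrictedLie.of_injective (f : V →ₗ[k] W) (hf : Function.Injective f)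
    (hb : ∀ x y, f (b x y) = b' (f x) (f y)) (hq : ∀ x, f (q x) = q' (f x))
    (h : IsRestrictedLie k p b' q') : IsRestrictedLie k p b q where
  isLieBracket := h.isLieBracket.of_injective f hf hb
  pmap_smul c x := hf (by simp [hq, h.pmap_smul])
  ad_pmap x y := hf (by rw [hb, hq, h.ad_pmap, map_iterate_bracket f hb])
  pmap_add x y := hf (by simp [hq, h.pmap_add, map_adCoeff f hb])

lemma IsRestrictedLie.of_surjective (f : V →ₗ[k] W) (hf : Function.Surjective f)
    (hb : ∀ x y, f (b x y) = b' (f x) (f y)) (hq : ∀ x, f (q x) = q' (f x))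
    (h : IsRestrictedLie k p b q) : IsRestrictedLie k p b' q' where
  isLieBracket := h.isLieBracket.of_surjective f hf hb
  pmap_smul c := hf.forall.2 fun x => by simp only [← hq, ← map_smul, h.pmap_smul]
  ad_pmap := hf.forall₂.2 fun x y => by rw [← hq, ← hb, h.ad_pmap, map_iterate_bracket f hb]
  pmap_add := hf.forall₂.2 fun x y => by
    simp only [← hq, ← map_add, h.pmap_add, ← map_adCoeff f hb, ← map_smul, ← map_sum]

lemma isLieBracket_commutator (A : Type u) [Ring A] [Algebra k A] :
    IsLieBracket k fun a b : A => a * b - b * a where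
  add_left x y z := by noncomm_ring
  add_right x y z := by noncomm_ring
  smul_left c x y := by simp [smul_sub]
  smul_right c x y := by simp [smul_sub]
  self x := sub_self _
  jacobi x y z := by noncomm_ring

lemma isRestrictedLie_commutator (p : ℕ) [Fact p.Prime] [CharP k p] (A : Type u) [Ring A]
    [Algebra k A] : IsRestrictedLie k p (fun a b : A => a * b - b * a) (fun a => a ^ p) where
  isLieBracket := isLieBracket_commutator A
  pmap_smul c x := smul_pow c x p
  ad_pmap x y := by
    have h := LinearMap.congr_fun (ad_pow_char k p x) y
    rw [Module.End.pow_apply] at h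
    exact h.symm
  pmap_add x y := add_pow_char_eq_sum_adCoeff k p x y

end RestrictedLie

/-! ### Quotient bialgebras -/

section Quotient

variable {k : Type u} [Field k] {A : Type u} [Ring A] [Bialgebra k A]

/-- A bialgebra map vanishing on a biideal factors through the quotient bialgebra. -/
noncomputable def biidealQuotientLift {B : Type u} [Ring B] [Bialgebra k B] (I : Ideal A)
    [I.IsTwoSided] [(I.restrictScalars k).IsCoideal] (f : A →ₐc[k] B) (hf : ∀ a ∈ I, f a = 0) :
    A ⧸ I →ₐc[k] B :=
  .ofAlgHom (Ideal.Quotient.liftₐ I (f : A →ₐ[k] B) hf)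
    (Ideal.Quotient.algHom_ext k (AlgHom.ext fun a =>
      CoalgHomClass.counit_comp_apply f a))
    (Ideal.Quotient.algHom_ext k (AlgHom.ext fun a => by
      change TensorProduct.map _ _ (TensorProduct.map _ _ (Coalgebra.comul (R := k) a)) =
        Coalgebra.comul (R := k) (f a)
      rw [← CoalgHomClass.map_comp_comul_apply, ← LinearMap.comp_apply, ← TensorProduct.map_comp]
      rfl))

variable {S : Set A} (hS : S ⊆ primitives k A)

lemma quotientByPrimitivesMk_surjective :
    Function.Surjective (quotientByPrimitivesMk S hS).toBialgHom :=
  Ideal.Quotient.mk_surjective (R := A) (I := twoSidedIdealSpan S)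

lemma quotientByPrimitivesMk_eq_zero_iff {a : A} :
    (quotientByPrimitivesMk S hS).toBialgHom a = 0 ↔ a ∈ TwoSidedIdeal.span S :=
  (Ideal.Quotient.eq_zero_iff_mem (I := twoSidedIdealSpan S)).trans TwoSidedIdeal.mem_asIdeal

lemma map_eq_zero_of_mem_span {B : Type u} [Ring B] [Bialgebra k B] {f : A →ₐc[k] B}
    (hf : ∀ s ∈ S, f s = 0) {a : A} (ha : a ∈ TwoSidedIdeal.span S) : f a = 0 := by
  have : TwoSidedIdeal.span S ≤ TwoSidedIdeal.ker (f : A →ₐ[k] B) :=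
    TwoSidedIdeal.span_le.2 fun s hs => (TwoSidedIdeal.mem_ker _).2 (hf s hs)
  exact (TwoSidedIdeal.mem_ker _).1 (this ha)

/-- The universal property of `A / (S)`. -/
noncomputable def quotientByPrimitivesLift {B : BialgCat.{u} k} (f : BialgCat.of k A ⟶ B)
    (hf : ∀ s ∈ S, f.toBialgHom s = 0) : quotientByPrimitives S hS ⟶ B :=
  haveI := isCoideal_twoSidedIdealSpan hS
  BialgCat.ofHom (biidealQuotientLift (twoSidedIdealSpan S) f.toBialgHom fun _ ha =>
    map_eq_zero_of_mem_span hf (TwoSidedIdeal.mem_asIdeal.1 ha))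

lemma quotientByPrimitivesMk_lift {B : BialgCat.{u} k} (f : BialgCat.of k A ⟶ B)
    (hf : ∀ s ∈ S, f.toBialgHom s = 0) :
    quotientByPrimitivesMk S hS ≫ quotientByPrimitivesLift hS f hf = f :=
  rfl

instance : Epi (quotientByPrimitivesMk S hS) where
  left_cancellation g h e := by
    refine BialgCat.hom_ext _ _ (BialgHom.ext fun x => ?_)
    obtain ⟨a, rfl⟩ := quotientByPrimitivesMk_surjective hS x
    exact BialgHom.congr_fun (congrArg BialgCat.Hom.toBialgHom e) a

/-- Sets of primitive elements generating the same ideal have isomorphic quotients under `A`. -/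
lemma exists_iso_quotientByPrimitives {S' : Set A} (hS' : S' ⊆ primitives k A)
    (h : TwoSidedIdeal.span S = TwoSidedIdeal.span S') :
    ∃ e : quotientByPrimitives S hS ≅ quotientByPrimitives S' hS',
      quotientByPrimitivesMk S hS ≫ e.hom = quotientByPrimitivesMk S' hS' := by
  have h₁ : ∀ s ∈ S, (quotientByPrimitivesMk S' hS').toBialgHom s = 0 := fun s hs =>
    (quotientByPrimitivesMk_eq_zero_iff hS').2 (h ▸ TwoSidedIdeal.subset_span hs)
  have h₂ : ∀ s ∈ S', (quotientByPrimitivesMk S hS).toBialgHom s = 0 := fun s hs =>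
    (quotientByPrimitivesMk_eq_zero_iff hS).2 (h ▸ TwoSidedIdeal.subset_span hs)
  refine ⟨⟨quotientByPrimitivesLift hS _ h₁, quotientByPrimitivesLift hS' _ h₂, ?_, ?_⟩, ?_⟩
  · rw [← cancel_epi (quotientByPrimitivesMk S hS), ← Category.assoc, quotientByPrimitivesMk_lift,
      quotientByPrimitivesMk_lift, Category.comp_id]
  · rw [← cancel_epi (quotientByPrimitivesMk S' hS'), ← Category.assoc, quotientByPrimitivesMk_lift,
      quotientByPrimitivesMk_lift, Category.comp_id]
  · exact quotientByPrimitivesMk_lift hS _ h₁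

end Quotient

/-! ### Primitive elements of quotients of tensor algebras -/

section TensorQuotient

variable {k : Type u} [Field k] {V : Type u} [AddCommGroup V] [Module k V]

/-- The primitive elements of a bialgebra generated by `V` are obtained from `V` by linear
combinations, commutators and, in characteristic `p > 0`, `p`-th powers. -/
lemma primitives_le_of_tensorAlgebra_surjective {B : Type u} [Ring B] [Bialgebra k B]
    (f : TensorAlgebra k V →ₐc[k] B) (hf : Function.Surjective f) {g : Submodule k B}
    (hg : g ≤ primitives k B) (hι : ∀ v, f (TensorAlgebra.ι k v) ∈ g)
    (hcomm : ∀ x ∈ g, ∀ y ∈ g, x * y - y * x ∈ g)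
    (hpow : ∀ q : ℕ, q.Prime → (q : k) = 0 → ∀ x ∈ g, x ^ q ∈ g) : primitives k B ≤ g := by
  refine primitives_le_of_adjoin_eq_top hg hcomm hpow (top_le_iff.1 ?_)
  have h := congrArg (Subalgebra.map (f : TensorAlgebra k V →ₐ[k] B))
    (TensorAlgebra.adjoin_range_ι (R := k) (M := V))
  have hr : (f : TensorAlgebra k V →ₐ[k] B).range = ⊤ := (AlgHom.range_eq_top _).2 hf
  rw [AlgHom.map_adjoin, Algebra.map_top, hr] at h
  rw [← h]
  refine Algebra.adjoin_mono ?_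
  rintro _ ⟨_, ⟨v, rfl⟩, rfl⟩
  exact hι v

/-- Every primitive element of a quotient of `TV` lifts to a primitive element of `TV`. -/
lemma exists_primitive_lift {B : Type u} [Ring B] [Bialgebra k B]
    (f : TensorAlgebra k V →ₐc[k] B) (hf : Function.Surjective f) {x : B}
    (hx : x ∈ primitives k B) : ∃ z ∈ primitives k (TensorAlgebra k V), f z = x := by
  have h := primitives_le_of_tensorAlgebra_surjective f hf
    (g := (primitives k (TensorAlgebra k V)).map (f : TensorAlgebra k V →ₐ[k] B).toLinearMap)
    ?_ ?_ ?_ ?_ hx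
  · exact h
  · rintro _ ⟨z, hz, rfl⟩
    exact map_mem_primitives f hz
  · exact fun v => ⟨_, ι_mem_primitives v, rfl⟩
  · rintro _ ⟨z, hz, rfl⟩ _ ⟨w, hw, rfl⟩
    exact ⟨_, commutator_mem_primitives hz hw, by simp⟩
  · rintro q hq hq0 _ ⟨z, hz, rfl⟩
    have : Fact q.Prime := ⟨hq⟩
    have : CharP k q := (CharP.charP_iff_prime_eq_zero hq).2 hq0
    exact ⟨_, pow_mem_primitives q hz, by simp⟩

end TensorQuotient

/-! ### The Lie structure on an algebra over the monad `PT` -/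

section StructureMap

lemma coe_primitivesMap {k : Type u} [Field k] {A B : Type u} [Ring A] [Bialgebra k A] [Ring B]
    [Bialgebra k B] (f : A →ₐc[k] B) (a : primitives k A) : (primitivesMap f a : B) = f a :=
  rfl

variable {k : Type u} [Field k] (V₁ : PTAlgebra k)

lemma structureMap_primitiveι (v : V₁.A) : structureMap V₁ (primitiveι V₁.A v) = v :=
  LinearMap.congr_fun (congrArg ModuleCat.Hom.hom V₁.unit) v

lemma structureMap_surjective : Function.Surjective (structureMap V₁) :=
  fun v => ⟨_, structureMap_primitiveι V₁ v⟩

/-- Associativity of `μ₀`, for an element of `P(T(P(TV₀)))`. -/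
lemma structureMap_primitivesMap
    (w : primitives k (TensorAlgebra k (primitives k (TensorAlgebra k V₁.A)))) :
    structureMap V₁ (primitivesMap (tensorLift LinearMap.id) w) =
      structureMap V₁ (primitivesMap (tensorLift (primitiveι V₁.A ∘ₗ structureMap V₁)) w) :=
  LinearMap.congr_fun (congrArg ModuleCat.Hom.hom V₁.assoc) w

lemma structureMap_commutator (z w : primitives k (TensorAlgebra k V₁.A)) :
    structureMap V₁ ⟨(z : TensorAlgebra k V₁.A) * w - w * z,
        commutator_mem_primitives z.2 w.2⟩ =
      structureMap V₁ ⟨TensorAlgebra.ι k (structureMap V₁ z) * TensorAlgebra.ι k (structureMap V₁ w)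
          - TensorAlgebra.ι k (structureMap V₁ w) * TensorAlgebra.ι k (structureMap V₁ z),
        commutator_mem_primitives (ι_mem_primitives _) (ι_mem_primitives _)⟩ := by
  have h := structureMap_primitivesMap V₁
    ⟨_, commutator_mem_primitives (ι_mem_primitives z) (ι_mem_primitives w)⟩
  convert h using 2
  · refine Subtype.ext ?_
    simp [coe_primitivesMap]
  · refine Subtype.ext ?_
    simp [coe_primitivesMap, primitiveι]

lemma structureMap_pow (p : ℕ) [Fact p.Prime] [CharP k p]
    (z : primitives k (TensorAlgebra k V₁.A)) :
    structureMap V₁ ⟨(z : TensorAlgebra k V₁.A) ^ p, pow_mem_primitives p z.2⟩ =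
      structureMap V₁ ⟨TensorAlgebra.ι k (structureMap V₁ z) ^ p,
        pow_mem_primitives p (ι_mem_primitives _)⟩ := by
  have h := structureMap_primitivesMap V₁ ⟨_, pow_mem_primitives p (ι_mem_primitives z)⟩
  convert h using 2
  · refine Subtype.ext ?_
    simp [coe_primitivesMap]
  · refine Subtype.ext ?_
    simp [coe_primitivesMap, primitiveι]

lemma ι_commutator_mem_primitives (x y : V₁.A) :
    TensorAlgebra.ι k x * TensorAlgebra.ι k y - TensorAlgebra.ι k y * TensorAlgebra.ι k x ∈
      primitives k (TensorAlgebra k V₁.A) :=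
  commutator_mem_primitives (ι_mem_primitives x) (ι_mem_primitives y)

lemma isLieBracket_inducedBracket :
    IsLieBracket k (inducedBracket V₁ (ι_commutator_mem_primitives V₁)) := by
  have h : IsLieBracket k fun z w : primitives k (TensorAlgebra k V₁.A) =>
      (⟨(z : TensorAlgebra k V₁.A) * w - w * z, commutator_mem_primitives z.2 w.2⟩ :
        primitives k (TensorAlgebra k V₁.A)) :=
    (isLieBracket_commutator _).of_injective (Submodule.subtype _) Subtype.val_injective
      fun _ _ => rfl
  exact h.of_surjective _ (structureMap_surjective V₁) (structureMap_commutator V₁)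

lemma isRestrictedLie_induced (p : ℕ) [Fact p.Prime] [CharP k p] :
    IsRestrictedLie k p (inducedBracket V₁ (ι_commutator_mem_primitives V₁))
      (inducedPower V₁ p fun x => pow_mem_primitives p (ι_mem_primitives x)) := by
  have h : IsRestrictedLie k p (fun z w : primitives k (TensorAlgebra k V₁.A) =>
      (⟨(z : TensorAlgebra k V₁.A) * w - w * z, commutator_mem_primitives z.2 w.2⟩ :
        primitives k (TensorAlgebra k V₁.A)))
      (fun z => ⟨(z : TensorAlgebra k V₁.A) ^ p, pow_mem_primitives p z.2⟩) :=
    (isRestrictedLie_commutator p _).of_injective (Submodule.subtype _) Subtype.val_injective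
      (fun _ _ => rfl) fun _ => rfl
  exact h.of_surjective _ (structureMap_surjective V₁) (structureMap_commutator V₁)
    (structureMap_pow V₁ p)

/-- The relations `z = μ₀ z` for all primitive `z` follow from those for commutators and `p`-th
powers of elements of `V₀`: in a quotient of `TV₀` where the latter hold, the `z` satisfying the
former are closed under commutators and `p`-th powers, hence exhaust `P(TV₀)`. -/
lemma structureRelations_subset_span {S : Set (TensorAlgebra k V₁.A)}
    (hS : S ⊆ primitives k (TensorAlgebra k V₁.A))
    (hlie : lieRelations k (inducedBracket V₁ (ι_commutator_mem_primitives V₁)) ⊆ S)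
    (hpow : ∀ (q : ℕ) [Fact q.Prime] [CharP k q], powerRelations k q
      (inducedPower V₁ q fun x => pow_mem_primitives q (ι_mem_primitives x)) ⊆ S) :
    structureRelations V₁ ⊆ TwoSidedIdeal.span S := by
  let f : TensorAlgebra k V₁.A →ₐc[k] quotientByPrimitives S hS :=
    (quotientByPrimitivesMk S hS).toBialgHom
  have hzero : ∀ a b : TensorAlgebra k V₁.A, a - b ∈ S → f a = f b := fun a b h =>
    sub_eq_zero.1 ((map_sub f a b).symm.trans
      ((quotientByPrimitivesMk_eq_zero_iff hS).2 (TwoSidedIdeal.subset_span h)))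
  let d : primitives k (TensorAlgebra k V₁.A) →ₗ[k] quotientByPrimitives S hS :=
    (f : TensorAlgebra k V₁.A →ₐ[k] quotientByPrimitives S hS).toLinearMap ∘ₗ
      ((primitives k (TensorAlgebra k V₁.A)).subtype - TensorAlgebra.ι k ∘ₗ structureMap V₁)
  have hd : ∀ z, d z = f z - f (TensorAlgebra.ι k (structureMap V₁ z)) := fun z => map_sub f _ _
  have key : primitives k (TensorAlgebra k V₁.A) ≤
      (LinearMap.ker d).map (primitives k (TensorAlgebra k V₁.A)).subtype := by
    refine primitives_le_of_tensorAlgebra_surjective (BialgHom.id k (TensorAlgebra k V₁.A))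
      Function.surjective_id ?_ ?_ ?_ ?_
    · rintro _ ⟨z, -, rfl⟩
      exact z.2
    · intro v
      refine ⟨primitiveι V₁.A v, ?_, rfl⟩
      rw [SetLike.mem_coe, LinearMap.mem_ker, hd, structureMap_primitiveι]
      exact sub_self _
    · rintro _ ⟨z, hz, rfl⟩ _ ⟨w, hw, rfl⟩
      refine ⟨⟨_, commutator_mem_primitives z.2 w.2⟩, ?_, rfl⟩
      rw [SetLike.mem_coe, LinearMap.mem_ker, hd, sub_eq_zero] at hz hw ⊢
      rw [structureMap_commutator]
      refine Eq.trans ?_ (hzero _ _ (hlie ⟨structureMap V₁ z, structureMap V₁ w, rfl⟩))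
      simp only [map_sub, map_mul, hz, hw]
    · rintro q hq hq0 _ ⟨z, hz, rfl⟩
      have : Fact q.Prime := ⟨hq⟩
      have : CharP k q := (CharP.charP_iff_prime_eq_zero hq).2 hq0
      refine ⟨⟨_, pow_mem_primitives q z.2⟩, ?_, rfl⟩
      rw [SetLike.mem_coe, LinearMap.mem_ker, hd, sub_eq_zero] at hz ⊢
      rw [structureMap_pow]
      refine Eq.trans ?_ (hzero _ _ (hpow q ⟨structureMap V₁ z, rfl⟩))
      simp only [map_pow, hz]
  rintro _ ⟨_, ⟨z, rfl⟩, rfl⟩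
  obtain ⟨z', hz', e⟩ := key z.2
  obtain rfl : z' = z := Subtype.ext e
  exact (quotientByPrimitivesMk_eq_zero_iff hS).1 hz'

lemma sub_structureMap_mem_structureRelations {a : TensorAlgebra k V₁.A}
    (ha : a ∈ primitives k (TensorAlgebra k V₁.A)) :
    a - TensorAlgebra.ι k (structureMap V₁ ⟨a, ha⟩) ∈ structureRelations V₁ :=
  ⟨_, ⟨⟨a, ha⟩, rfl⟩, rfl⟩

lemma lieRelations_subset_structureRelations :
    lieRelations k (inducedBracket V₁ (ι_commutator_mem_primitives V₁)) ⊆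
      structureRelations V₁ := by
  rintro _ ⟨x, y, rfl⟩
  exact sub_structureMap_mem_structureRelations V₁ _

lemma powerRelations_subset_structureRelations (p : ℕ) [Fact p.Prime] [CharP k p] :
    powerRelations k p (inducedPower V₁ p fun x => pow_mem_primitives p (ι_mem_primitives x)) ⊆
      structureRelations V₁ := by
  rintro _ ⟨x, rfl⟩
  exact sub_structureMap_mem_structureRelations V₁ _

lemma span_structureRelations_of_charZero [CharZero k] :
    TwoSidedIdeal.span (structureRelations V₁) = TwoSidedIdeal.span
      (lieRelations k (inducedBracket V₁ (ι_commutator_mem_primitives V₁))) := by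
  refine le_antisymm (TwoSidedIdeal.span_le.2 (structureRelations_subset_span V₁
    (lieRelations_subset k _) le_rfl fun q _ _ => ?_))
    (TwoSidedIdeal.span_mono (lieRelations_subset_structureRelations V₁))
  exact absurd (CharP.eq k ‹CharP k q› (CharP.ofCharZero k)) (Fact.out : q.Prime).ne_zero

lemma span_structureRelations_of_charP (p : ℕ) [Fact p.Prime] [CharP k p] :
    TwoSidedIdeal.span (structureRelations V₁) = TwoSidedIdeal.span
      (lieRelations k (inducedBracket V₁ (ι_commutator_mem_primitives V₁)) ∪
        powerRelations k p
          (inducedPower V₁ p fun x => pow_mem_primitives p (ι_mem_primitives x))) := by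
  refine le_antisymm (TwoSidedIdeal.span_le.2 (structureRelations_subset_span V₁
    (restrictedRelations_subset k p _ _) Set.subset_union_left fun q _ _ => ?_))
    (TwoSidedIdeal.span_mono (Set.union_subset (lieRelations_subset_structureRelations V₁)
      (powerRelations_subset_structureRelations V₁ p)))
  obtain rfl : q = p := CharP.eq k ‹_› ‹_›
  exact Set.subset_union_right

end StructureMap

noncomputable section

/-! ### Idempotent adjunctions -/

section IdempotentAdjunction

variable {C : Type u₁} [Category.{v₁} C] {D : Type u₂} [Category.{v₂} D] {L : C ⥤ D} {R : D ⥤ C}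

/-- An adjunction is idempotent as soon as `L` sends the unit to epimorphisms: these are already
split monomorphisms, with the counit at `L X` as retraction. -/
lemma isIdempotentAdjunction_of_epi (adj : L ⊣ R) (h : ∀ X, Epi (L.map (adj.unit.app X))) :
    IsIdempotentAdjunction adj := by
  have hc : ∀ X, IsIso (adj.counit.app (L.obj X)) := fun X => by
    have := h X
    have : IsSplitMono (L.map (adj.unit.app X)) := ⟨⟨_, adj.left_triangle_components X⟩⟩
    have : IsIso (L.map (adj.unit.app X)) := isIso_of_epi_of_isSplitMono _
    exact IsIso.of_isIso_fac_left (adj.left_triangle_components X)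
  have : ∀ X, IsIso (adj.toMonad.μ.app X) := fun X => by
    have := hc X
    change IsIso (R.map (adj.counit.app (L.obj X)))
    infer_instance
  exact NatIso.isIso_of_isIso_app _

/-- Over an idempotent monad the structure map of an algebra is inverse to the unit. -/
lemma algebra_a_comp_unit {adj : L ⊣ R} (h : IsIdempotentAdjunction adj)
    (X : adj.toMonad.Algebra) : X.a ≫ adj.unit.app X.A = 𝟙 _ := by
  have : IsIso adj.toMonad.μ := h
  have e : adj.toMonad.η.app (adj.toMonad.obj X.A) = adj.toMonad.map (adj.toMonad.η.app X.A) := by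
    rw [← cancel_mono (adj.toMonad.μ.app X.A), Monad.left_unit, Monad.right_unit]
    rfl
  have h₁ := adj.toMonad.η.naturality X.a
  have h₂ : X.a ≫ adj.toMonad.η.app X.A = 𝟙 _ := by
    refine h₁.trans ?_
    change adj.toMonad.η.app (adj.toMonad.obj X.A) ≫ adj.toMonad.map X.a = 𝟙 _
    rw [e, ← CategoryTheory.Functor.map_comp, X.unit]
    exact adj.toMonad.map_id _
  exact h₂

/-- Algebra morphisms over an idempotent monad are just morphisms of the underlying objects. -/
def algebraHomOfIdempotent {adj : L ⊣ R} (h : IsIdempotentAdjunction adj)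
    {X Y : adj.toMonad.Algebra} (f : X.A ⟶ Y.A) : X ⟶ Y where
  f := f
  h := by
    have e : adj.toMonad.η.app X.A ≫ adj.toMonad.map f ≫ Y.a = f := by
      have := adj.toMonad.η.naturality_assoc f Y.a
      exact this.symm.trans (by rw [Y.unit]; exact Category.comp_id _)
    have h₂ : X.a ≫ adj.toMonad.η.app X.A = 𝟙 _ := algebra_a_comp_unit h X
    calc adj.toMonad.map f ≫ Y.a
        = (X.a ≫ adj.toMonad.η.app X.A) ≫ adj.toMonad.map f ≫ Y.a := by
          rw [h₂, Category.id_comp]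
      _ = X.a ≫ f := by rw [Category.assoc, e]

/-- For an idempotent adjunction `L ⊣ R`, forgetting the algebra structure and applying `L` is left
adjoint to the comparison functor. -/
def comparisonAdjunctionOfIdempotent {adj : L ⊣ R} (h : IsIdempotentAdjunction adj) :
    adj.toMonad.forget ⋙ L ⊣ Monad.comparison adj :=
  Adjunction.mkOfHomEquiv
    { homEquiv X A :=
        { toFun f := algebraHomOfIdempotent h (adj.homEquiv X.A A f)
          invFun g := (adj.homEquiv X.A A).symm g.f
          left_inv f := (adj.homEquiv X.A A).left_inv f
          right_inv g := Monad.Algebra.Hom.ext ((adj.homEquiv X.A A).right_inv g.f) }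
      homEquiv_naturality_left_symm f g := adj.homEquiv_naturality_left_symm f.f g.f
      homEquiv_naturality_right f g :=
        Monad.Algebra.Hom.ext (adj.homEquiv_naturality_right f g) }

lemma comparisonAdjunctionOfIdempotent_unit_f {adj : L ⊣ R} (h : IsIdempotentAdjunction adj)
    (X : adj.toMonad.Algebra) :
    ((comparisonAdjunctionOfIdempotent h).unit.app X).f = adj.unit.app X.A := by
  have := (comparisonAdjunctionOfIdempotent h).homEquiv_id X
  rw [← this, comparisonAdjunctionOfIdempotent, Adjunction.mkOfHomEquiv_homEquiv]
  exact adj.homEquiv_id X.A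

lemma full_faithful_of_idempotent {adj : L ⊣ R} (h : IsIdempotentAdjunction adj)
    {L' : adj.toMonad.Algebra ⥤ D} (adj' : L' ⊣ Monad.comparison adj) : L'.Full ∧ L'.Faithful := by
  have hunit : ∀ X, IsIso ((comparisonAdjunctionOfIdempotent h).unit.app X) := fun X => by
    refine ⟨algebraHomOfIdempotent h X.a, Monad.Algebra.Hom.ext ?_, Monad.Algebra.Hom.ext ?_⟩
    · change ((comparisonAdjunctionOfIdempotent h).unit.app X).f ≫ X.a = 𝟙 _
      rw [comparisonAdjunctionOfIdempotent_unit_f]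
      exact X.unit
    · change X.a ≫ ((comparisonAdjunctionOfIdempotent h).unit.app X).f = 𝟙 _
      rw [comparisonAdjunctionOfIdempotent_unit_f]
      exact algebra_a_comp_unit h X
  have : IsIso (comparisonAdjunctionOfIdempotent h).unit := NatIso.isIso_of_isIso_app _
  have ff := (comparisonAdjunctionOfIdempotent h).fullyFaithfulLOfIsIsoUnit
  have := ff.full
  have := ff.faithful
  let i := (comparisonAdjunctionOfIdempotent h).leftAdjointUniq adj'
  exact ⟨Functor.Full.of_iso i, Functor.Faithful.of_iso i⟩

end IdempotentAdjunction

/-! ### The left adjoints of the comparison functors -/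

section ComparisonOne

variable {k : Type u} [Field k]

lemma tensorPrimitivesAdjunction_homEquiv_symm {V : ModuleCat.{u} k} {A : BialgCat.{u} k}
    (f : V ⟶ ModuleCat.of k (primitives k A)) :
    ((tensorPrimitivesAdjunction k).homEquiv V A).symm f = BialgCat.ofHom (tensorLift f.hom) := by
  rw [tensorPrimitivesAdjunction, Adjunction.mkOfHomEquiv_homEquiv]
  rfl

/-- A linear map `V₀ → P(A)` is a morphism `(V₀, μ₀) → R₁ A` precisely when the corresponding map
`TV₀ → A` kills the structure relations. -/
lemma algebraHom_iff (V₁ : PTAlgebra k) (A : BialgCat.{u} k)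
    (f : V₁.A ⟶ ModuleCat.of k (primitives k A)) :
    (tensorPrimitivesAdjunction k).toMonad.map f ≫ ((comparisonOne k).obj A).a = V₁.a ≫ f ↔
      ∀ s ∈ structureRelations V₁, tensorLift f.hom s = 0 := by
  have e : (tensorPrimitivesAdjunction k).toMonad.map f ≫ ((comparisonOne k).obj A).a =
      (primitivesFunctor k).map (BialgCat.ofHom (tensorLift f.hom)) :=
    ((primitivesFunctor k).map_comp _ _).symm.trans (congrArg (primitivesFunctor k).map
      (((tensorPrimitivesAdjunction k).homEquiv_counit (Y := A) (g := f)).symm.trans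
        (tensorPrimitivesAdjunction_homEquiv_symm f)))
  have hz : ∀ z : primitives k (TensorAlgebra k V₁.A),
      tensorLift f.hom ((z : TensorAlgebra k V₁.A) - TensorAlgebra.ι k (structureMap V₁ z)) = 0 ↔
      primitivesMap (tensorLift f.hom) z = f.hom (structureMap V₁ z) := by
    intro z
    rw [map_sub, tensorLift_ι, sub_eq_zero, ← coe_primitivesMap, Subtype.coe_inj]
  rw [e]
  constructor
  · rintro h _ ⟨_, ⟨z, rfl⟩, rfl⟩
    exact (hz z).2 (LinearMap.congr_fun (congrArg ModuleCat.Hom.hom h) z)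
  · intro h
    refine ModuleCat.hom_ext (LinearMap.ext fun z => ?_)
    exact (hz z).1 (h _ (sub_structureMap_mem_structureRelations V₁ z.2))

/-- Bialgebra maps out of `TV₀ / (Im (Id - η₀ ∘ μ₀))` are morphisms out of `(V₀, μ₀)`. -/
def structureQuotientHomEquiv (V₁ : PTAlgebra k) (A : BialgCat.{u} k) :
    (quotientByPrimitives (structureRelations V₁) (structureRelations_subset V₁) ⟶ A) ≃
      (V₁ ⟶ (comparisonOne k).obj A) where
  toFun g :=
    { f := (tensorPrimitivesAdjunction k).homEquiv V₁.A A
        (quotientByPrimitivesMk (structureRelations V₁) (structureRelations_subset V₁) ≫ g)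
      h := by
        refine (algebraHom_iff V₁ A _).2 fun s hs => ?_
        have e := tensorPrimitivesAdjunction_homEquiv_symm
          ((tensorPrimitivesAdjunction k).homEquiv V₁.A A
            (quotientByPrimitivesMk (structureRelations V₁) (structureRelations_subset V₁) ≫ g))
        rw [Equiv.symm_apply_apply] at e
        refine (BialgHom.congr_fun (congrArg BialgCat.Hom.toBialgHom e) s).symm.trans ?_
        have h0 := (quotientByPrimitivesMk_eq_zero_iff (structureRelations_subset V₁)).2
          (TwoSidedIdeal.subset_span hs)
        exact (congrArg g.toBialgHom h0).trans (map_zero g.toBialgHom) }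
  invFun h := quotientByPrimitivesLift (structureRelations_subset V₁)
    (((tensorPrimitivesAdjunction k).homEquiv V₁.A A).symm h.f) fun s hs => by
      rw [tensorPrimitivesAdjunction_homEquiv_symm (A := A) h.f]
      exact (algebraHom_iff V₁ A h.f).1 h.h s hs
  left_inv g := by
    rw [← cancel_epi (quotientByPrimitivesMk _ _)]
    exact (quotientByPrimitivesMk_lift _ _ _).trans (Equiv.symm_apply_apply _ _)
  right_inv h := Monad.Algebra.Hom.ext
    ((congrArg ((tensorPrimitivesAdjunction k).homEquiv V₁.A A)
      (quotientByPrimitivesMk_lift (structureRelations_subset V₁) _ _)).trans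
        (Equiv.apply_symm_apply _ _))

lemma structureQuotientHomEquiv_naturality (V₁ : PTAlgebra k) (A A' : BialgCat.{u} k)
    (g : A ⟶ A')
    (h : quotientByPrimitives (structureRelations V₁) (structureRelations_subset V₁) ⟶ A) :
    structureQuotientHomEquiv V₁ A' (h ≫ g) =
      structureQuotientHomEquiv V₁ A h ≫ (comparisonOne k).map g :=
  Monad.Algebra.Hom.ext ((tensorPrimitivesAdjunction k).homEquiv_naturality_right (X := V₁.A)
    (quotientByPrimitivesMk (structureRelations V₁) (structureRelations_subset V₁) ≫ h) g)

/-- The left adjoint `(V₀, μ₀) ↦ TV₀ / (Im (Id - η₀ ∘ μ₀))` of `R₁`. -/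
def structureQuotientAdjunction (k : Type u) [Field k] :
    Adjunction.leftAdjointOfEquiv structureQuotientHomEquiv structureQuotientHomEquiv_naturality ⊣
      comparisonOne k :=
  Adjunction.adjunctionOfEquivLeft _ _

lemma canonicalOne_structureQuotientAdjunction (V₁ : PTAlgebra k) :
    canonicalOne (structureQuotientAdjunction k) V₁ =
      quotientByPrimitivesMk (structureRelations V₁) (structureRelations_subset V₁) := by
  have h : (structureQuotientAdjunction k).unit.app V₁ =
      structureQuotientHomEquiv V₁ _ (𝟙 _) := by
    rw [← Adjunction.homEquiv_id, structureQuotientAdjunction, Adjunction.adjunctionOfEquivLeft,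
      Adjunction.mkOfHomEquiv_homEquiv]
    rfl
  refine (Equiv.symm_apply_eq _).2 ((congrArg Monad.Algebra.Hom.f h).trans ?_)
  exact congrArg ((tensorPrimitivesAdjunction k).homEquiv V₁.A _) (Category.comp_id _)

variable {L₁ : PTAlgebra k ⥤ BialgCat.{u} k} (adj₁ : L₁ ⊣ comparisonOne k)

lemma canonicalOne_comp_leftAdjointUniq {L₁' : PTAlgebra k ⥤ BialgCat.{u} k}
    (adj₁' : L₁' ⊣ comparisonOne k) (V₁ : PTAlgebra k) :
    canonicalOne adj₁ V₁ ≫ (adj₁.leftAdjointUniq adj₁').hom.app V₁ = canonicalOne adj₁' V₁ :=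
  ((tensorPrimitivesAdjunction k).homEquiv_naturality_right_symm (X := V₁.A)
    (adj₁.unit.app V₁).f _).symm.trans
    (congrArg ((tensorPrimitivesAdjunction k).homEquiv V₁.A _).symm
      (congrArg Monad.Algebra.Hom.f (adj₁.unit_leftAdjointUniq_hom_app adj₁' V₁)))

lemma exists_iso_structureQuotient (V₁ : PTAlgebra k) :
    ∃ e : L₁.obj V₁ ≅
        quotientByPrimitives (structureRelations V₁) (structureRelations_subset V₁),
      canonicalOne adj₁ V₁ ≫ e.hom =
        quotientByPrimitivesMk (structureRelations V₁) (structureRelations_subset V₁) :=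
  ⟨(adj₁.leftAdjointUniq (structureQuotientAdjunction k)).app V₁,
    (canonicalOne_comp_leftAdjointUniq adj₁ (structureQuotientAdjunction k) V₁).trans
      (canonicalOne_structureQuotientAdjunction V₁)⟩

lemma canonicalOne_naturality {V₁ W₁ : PTAlgebra k} (f : V₁ ⟶ W₁) :
    (tensorFunctor k).map f.f ≫ canonicalOne adj₁ W₁ = canonicalOne adj₁ V₁ ≫ L₁.map f :=
  ((tensorPrimitivesAdjunction k).homEquiv_naturality_left_symm f.f (adj₁.unit.app W₁).f).symm.trans
    ((congrArg ((tensorPrimitivesAdjunction k).homEquiv V₁.A _).symm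
      (congrArg Monad.Algebra.Hom.f (adj₁.unit.naturality f))).trans
    ((tensorPrimitivesAdjunction k).homEquiv_naturality_right_symm (X := V₁.A)
      (adj₁.unit.app V₁).f (L₁.map f)))

lemma canonicalOne_surjective (V₁ : PTAlgebra k) :
    Function.Surjective (canonicalOne adj₁ V₁).toBialgHom := by
  obtain ⟨e, he⟩ := exists_iso_structureQuotient adj₁ V₁
  have : canonicalOne adj₁ V₁ = quotientByPrimitivesMk _ _ ≫ e.inv := by
    rw [← he, Category.assoc, e.hom_inv_id, Category.comp_id]
  rw [this]
  exact (e.symm.toBialgEquiv.surjective).comp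
    (quotientByPrimitivesMk_surjective (structureRelations_subset V₁))

lemma canonicalOne_epi (V₁ : PTAlgebra k) : Epi (canonicalOne adj₁ V₁) where
  left_cancellation g h e := by
    refine BialgCat.hom_ext _ _ (BialgHom.ext fun x => ?_)
    obtain ⟨a, rfl⟩ := canonicalOne_surjective adj₁ V₁ x
    exact BialgHom.congr_fun (congrArg BialgCat.Hom.toBialgHom e) a

lemma canonicalOne_ι_structureMap (V₁ : PTAlgebra k)
    (z : primitives k (TensorAlgebra k V₁.A)) :
    (canonicalOne adj₁ V₁).toBialgHom (TensorAlgebra.ι k (structureMap V₁ z)) =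
      (canonicalOne adj₁ V₁).toBialgHom (z : TensorAlgebra k V₁.A) := by
  obtain ⟨e, he⟩ := exists_iso_structureQuotient adj₁ V₁
  have : canonicalOne adj₁ V₁ = quotientByPrimitivesMk _ _ ≫ e.inv := by
    rw [← he, Category.assoc, e.hom_inv_id, Category.comp_id]
  rw [this]
  refine congrArg e.inv.toBialgHom (sub_eq_zero.1 ?_).symm
  refine (map_sub (quotientByPrimitivesMk (structureRelations V₁)
    (structureRelations_subset V₁)).toBialgHom (z : TensorAlgebra k V₁.A) _).symm.trans ?_
  exact (quotientByPrimitivesMk_eq_zero_iff (structureRelations_subset V₁)).2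
    (TwoSidedIdeal.subset_span (sub_structureMap_mem_structureRelations V₁ z.2))

/-- The linear map `V₀ → P(L₁ (V₀, μ₀))` underlying the unit of `L₁ ⊣ R₁`. -/
def unitLinearMap (V₁ : PTAlgebra k) : V₁.A →ₗ[k] primitives k (L₁.obj V₁) :=
  ModuleCat.Hom.hom (adj₁.unit.app V₁).f

lemma canonicalOne_ι (V₁ : PTAlgebra k) (v : V₁.A) :
    (canonicalOne adj₁ V₁).toBialgHom (TensorAlgebra.ι k v) =
      (unitLinearMap adj₁ V₁ v : L₁.obj V₁) := by
  have h := tensorPrimitivesAdjunction_homEquiv_symm (A := L₁.obj V₁) (adj₁.unit.app V₁).f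
  exact (BialgHom.congr_fun (congrArg BialgCat.Hom.toBialgHom h) _).trans (tensorLift_ι _ v)

/-- The unit `V₀ → P(L₁ (V₀, μ₀))` is surjective: primitive elements of `L₁ (V₀, μ₀)` lift to
primitive elements `z` of `TV₀`, and `z` has the same image as `μ₀ z`. -/
lemma unitLinearMap_surjective (V₁ : PTAlgebra k) :
    Function.Surjective (unitLinearMap adj₁ V₁) := fun x => by
  obtain ⟨z, hz, hx⟩ := exists_primitive_lift (V := V₁.A) (canonicalOne adj₁ V₁).toBialgHom
    (canonicalOne_surjective adj₁ V₁) x.2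
  refine ⟨structureMap V₁ ⟨z, hz⟩, Subtype.ext ?_⟩
  exact (canonicalOne_ι adj₁ V₁ _).symm.trans
    ((canonicalOne_ι_structureMap adj₁ V₁ ⟨z, hz⟩).trans hx)

/-- `L₁` sends the unit to epimorphisms: `L₁ R₁ L₁ (V₀, μ₀)` is generated by the primitive elements
of `L₁ (V₀, μ₀)`, all of which come from `V₀`. -/
lemma epi_map_unit (V₁ : PTAlgebra k) : Epi (L₁.map (adj₁.unit.app V₁)) where
  left_cancellation {A} g h e := by
    set W₁ := (comparisonOne k).obj (L₁.obj V₁) with hW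
    have := canonicalOne_epi adj₁ W₁
    change L₁.obj W₁ ⟶ A at g h
    rw [← cancel_epi (canonicalOne adj₁ W₁)]
    refine BialgCat.hom_ext _ _ (tensor_bialgHom_ext (V := W₁.A) (A := A) fun x => ?_)
    obtain ⟨v, rfl⟩ := unitLinearMap_surjective adj₁ V₁ x
    have hn : ∀ g' : L₁.obj W₁ ⟶ A, (canonicalOne adj₁ W₁ ≫ g').toBialgHom (TensorAlgebra.ι k
        (unitLinearMap adj₁ V₁ v)) =
        (L₁.map (adj₁.unit.app V₁) ≫ g').toBialgHom
          ((canonicalOne adj₁ V₁).toBialgHom (TensorAlgebra.ι k v)) := fun g' => by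
      have h₁ := BialgHom.congr_fun (congrArg BialgCat.Hom.toBialgHom
        (canonicalOne_naturality adj₁ (adj₁.unit.app V₁))) (TensorAlgebra.ι k v)
      have h₂ : ((tensorFunctor k).map (adj₁.unit.app V₁).f).toBialgHom (TensorAlgebra.ι k v) =
          TensorAlgebra.ι k (unitLinearMap adj₁ V₁ v) := tensorLift_ι _ v
      refine congrArg g'.toBialgHom (Eq.trans ?_ h₁)
      exact congrArg (canonicalOne adj₁ W₁).toBialgHom h₂.symm
    exact (hn g).trans (Eq.trans (BialgHom.congr_fun (congrArg BialgCat.Hom.toBialgHom e) _)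
      (hn h).symm)

lemma isIdempotentAdjunction_comparisonOne : IsIdempotentAdjunction adj₁ :=
  isIdempotentAdjunction_of_epi adj₁ (epi_map_unit adj₁)

lemma exists_iso_comp_canonicalTwo {L₂ : adj₁.toMonad.Algebra ⥤ BialgCat.{u} k}
    (adj₂ : L₂ ⊣ Monad.comparison adj₁) (V₂ : adj₁.toMonad.Algebra) :
    ∃ e : L₂.obj V₂ ≅ L₁.obj V₂.A, canonicalTwo adj₂ V₂ ≫ e.hom = canonicalOne adj₁ V₂.A := by
  let adj₂' := comparisonAdjunctionOfIdempotent (isIdempotentAdjunction_comparisonOne adj₁)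
  refine ⟨(adj₂.leftAdjointUniq adj₂').app V₂, ?_⟩
  refine ((tensorPrimitivesAdjunction k).homEquiv_naturality_right_symm (X := V₂.A.A)
    (adj₂.unit.app V₂).f.f _).symm.trans
    (congrArg ((tensorPrimitivesAdjunction k).homEquiv V₂.A.A _).symm ?_)
  have h := congrArg Monad.Algebra.Hom.f (adj₂.unit_leftAdjointUniq_hom_app adj₂' V₂)
  rw [comparisonAdjunctionOfIdempotent_unit_f] at h
  exact congrArg Monad.Algebra.Hom.f h

lemma exists_iso_quotient_of_span_eq {L₂ : adj₁.toMonad.Algebra ⥤ BialgCat.{u} k}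
    (adj₂ : L₂ ⊣ Monad.comparison adj₁) (V₂ : adj₁.toMonad.Algebra)
    {S : Set (TensorAlgebra k V₂.A.A)} (hS : S ⊆ primitives k (TensorAlgebra k V₂.A.A))
    (h : TwoSidedIdeal.span (structureRelations V₂.A) = TwoSidedIdeal.span S) :
    ∃ e : L₂.obj V₂ ≅ quotientByPrimitives S hS,
      canonicalTwo adj₂ V₂ ≫ e.hom = quotientByPrimitivesMk S hS := by
  obtain ⟨e₁, h₁⟩ := exists_iso_comp_canonicalTwo adj₁ adj₂ V₂
  obtain ⟨e₂, h₂⟩ := exists_iso_structureQuotient adj₁ V₂.A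
  obtain ⟨e₃, h₃⟩ := exists_iso_quotientByPrimitives (structureRelations_subset V₂.A) hS h
  exact ⟨e₁ ≪≫ e₂ ≪≫ e₃, by
    simp only [Iso.trans_hom]
    rw [← h₃, ← h₂, ← h₁]
    simp only [Category.assoc]⟩

variable (k) in
lemma exists_hasMonadicDecomposition_primitivesFunctor :
    ∃ N : ℕ, N ≤ 2 ∧ HasMonadicDecomposition.{u, u + 1, u, u + 1} N (primitivesFunctor k) := by
  by_cases h₀ : (tensorFunctor k).Full ∧ (tensorFunctor k).Faithful
  · exact ⟨0, by omega, tensorFunctor k, ⟨tensorPrimitivesAdjunction k⟩, h₀⟩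
  let adj₁ := structureQuotientAdjunction k
  by_cases h₁ : (Adjunction.leftAdjointOfEquiv structureQuotientHomEquiv
      (structureQuotientHomEquiv_naturality (k := k))).Full ∧
      (Adjunction.leftAdjointOfEquiv structureQuotientHomEquiv
      (structureQuotientHomEquiv_naturality (k := k))).Faithful
  · exact ⟨1, by omega, tensorFunctor k, tensorPrimitivesAdjunction k, h₀, _, ⟨adj₁⟩, h₁⟩
  have hi := isIdempotentAdjunction_comparisonOne adj₁
  exact ⟨2, le_rfl, tensorFunctor k, tensorPrimitivesAdjunction k, h₀, _, adj₁, h₁, _,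
    ⟨comparisonAdjunctionOfIdempotent hi⟩,
    full_faithful_of_idempotent hi (comparisonAdjunctionOfIdempotent hi)⟩

end ComparisonOne

end

theorem theorem2p3 (k : Type u) [Field k] :
    (∃ N : ℕ, N ≤ 2 ∧ HasMonadicDecomposition.{u, u + 1, u, u + 1} N (primitivesFunctor k)) ∧
    (∃ L₁ : PTAlgebra k ⥤ BialgCat.{u} k, Nonempty (L₁ ⊣ comparisonOne k)) ∧
    ∀ (L₁ : PTAlgebra k ⥤ BialgCat.{u} k) (adj₁ : L₁ ⊣ comparisonOne k),
      (∀ V₁ : PTAlgebra k,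
        ∃ e : L₁.obj V₁ ≅
            quotientByPrimitives (structureRelations V₁) (structureRelations_subset V₁),
          canonicalOne adj₁ V₁ ≫ e.hom =
            quotientByPrimitivesMk (structureRelations V₁) (structureRelations_subset V₁)) ∧
      IsIdempotentAdjunction adj₁ ∧
      (∃ L₂ : adj₁.toMonad.Algebra ⥤ BialgCat.{u} k, Nonempty (L₂ ⊣ Monad.comparison adj₁)) ∧
      ∀ (L₂ : adj₁.toMonad.Algebra ⥤ BialgCat.{u} k) (adj₂ : L₂ ⊣ Monad.comparison adj₁),
        (L₂.Full ∧ L₂.Faithful) ∧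
        ∀ V₂ : adj₁.toMonad.Algebra,
          (CharZero k →
            ∃ hcomm : ∀ x y : V₂.A.A,
                TensorAlgebra.ι k x * TensorAlgebra.ι k y -
                  TensorAlgebra.ι k y * TensorAlgebra.ι k x ∈
                    primitives k (TensorAlgebra k V₂.A.A),
              IsLieBracket k (inducedBracket V₂.A hcomm) ∧
              ∃ e : L₂.obj V₂ ≅ envelopingBialgebra k (inducedBracket V₂.A hcomm),
                canonicalTwo adj₂ V₂ ≫ e.hom = envelopingMk k (inducedBracket V₂.A hcomm)) ∧
          (∀ (p : ℕ) [Fact p.Prime] [CharP k p],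
            ∃ (hcomm : ∀ x y : V₂.A.A,
                TensorAlgebra.ι k x * TensorAlgebra.ι k y -
                  TensorAlgebra.ι k y * TensorAlgebra.ι k x ∈
                    primitives k (TensorAlgebra k V₂.A.A))
              (hpow : ∀ x : V₂.A.A,
                TensorAlgebra.ι k x ^ p ∈ primitives k (TensorAlgebra k V₂.A.A)),
              IsRestrictedLie k p (inducedBracket V₂.A hcomm) (inducedPower V₂.A p hpow) ∧
              ∃ e : L₂.obj V₂ ≅ restrictedEnvelopingBialgebra k p
                  (inducedBracket V₂.A hcomm) (inducedPower V₂.A p hpow),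
                canonicalTwo adj₂ V₂ ≫ e.hom =
                  restrictedEnvelopingMk k p
                    (inducedBracket V₂.A hcomm) (inducedPower V₂.A p hpow)) := by
  refine ⟨exists_hasMonadicDecomposition_primitivesFunctor k,
    ⟨_, ⟨structureQuotientAdjunction k⟩⟩, fun L₁ adj₁ => ⟨exists_iso_structureQuotient adj₁,
    isIdempotentAdjunction_comparisonOne adj₁,
    ⟨_, ⟨comparisonAdjunctionOfIdempotent (isIdempotentAdjunction_comparisonOne adj₁)⟩⟩,
    fun L₂ adj₂ => ⟨full_faithful_of_idempotent (isIdempotentAdjunction_comparisonOne adj₁) adj₂,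
      fun V₂ => ⟨fun _ => ?_, fun p _ _ => ?_⟩⟩⟩⟩
  · exact ⟨ι_commutator_mem_primitives V₂.A, isLieBracket_inducedBracket V₂.A,
      exists_iso_quotient_of_span_eq adj₁ adj₂ V₂ (lieRelations_subset k _)
        (span_structureRelations_of_charZero V₂.A)⟩
  · exact ⟨ι_commutator_mem_primitives V₂.A, fun x => pow_mem_primitives p (ι_mem_primitives x),
      isRestrictedLie_induced V₂.A p,
      exists_iso_quotient_of_span_eq adj₁ adj₂ V₂ (restrictedRelations_subset k p _ _)
        (span_structureRelations_of_charP V₂.A p)⟩
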